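/- Let $k$ be an algebraically closed field of characteristic $0$, and for each integer $\ell\ge 1$ fix a primitive $\ell$-th root of unity $\zeta_\ell\in k^\times$. Let $\Lambda$ be a free abelian group of finite rank $n\ge 1$. Algebras are $k$-algebras, not necessarily associative or unital. A $\Lambda$-grading of an algebra $\mathcal B$ is a family of subspaces $\mathcal B^\lambda$ ($\lambda\in\Lambda$) with $\mathcal B=\bigoplus_{\lambda\in\Lambda}\mathcal B^\lambda$ and $\mathcal B^\lambda\mathcal B^\mu\subseteq\mathcal B^{\lambda+\mu}$; its support is $\{\lambda\in\Lambda : \mathcal B^\lambda\neq 0\}$. A unital associative (respectively alternative, Jordan) $\Lambda$-graded algebra $\mathcal B$ is an *associative* (respectively *alternative*, *Jordan*) *$\Lambda$-torus* if (a) for each $\lambda$ in the support, $\mathcal B^\lambda$ is spanned by an invertible element of $\mathcal B$, and (b) the support generates the group $\Lambda$. Here $x$ is invertible if there is a $y$ with $xy=yx=1$ in the associative and alternative cases, and with $xy=1$, $x^2y=x$ in the Jordan case. The *centroid* $C(\mathcal B)$ is the centralizer in $\operatorname{End}_k(\mathcal B)$ of all left and right multiplications by elements of $\mathcal B$; $\mathcal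 B$ is *fgc* if it is a finitely generated $C(\mathcal B)$-module. An algebra $\mathcal A$ is *simple* if $\mathcal A\mathcal A\ne 0$ and its only ideals are $0$ and $\mathcal A$. Given an algebra $\mathcal A$, positive integers $m_1,\dots,m_n$ and pairwise commuting algebra automorphisms $\sigma_1,\dots,\sigma_n$ of $\mathcal A$ with $\sigma_i^{m_i}=1$ for all $i$, the associated *multiloop algebra* is the $\mathbb Z^n$-graded subalgebra $$\bigoplus_{(\ell_1,\dots,\ell_n)\in\mathbb Z^n}\{u\in\mathcal A : \sigma_j u=\zeta_{m_j}^{\ell_j}u \text{ for } 1\le j\le n\}\otimes z_1^{\ell_1}\cdots z_n^{\ell_n}$$ of $\mathcal A\otimes_k k[z_1^{\pm1},\dots,z_n^{\pm1}]$, with the displayed grading. A $\Lambda$-graded algebra $\mathcal B$ *has a multiloop realization based on $\mathcal A$* if for some such $m_i,\sigma_i$ there are an algebra isomorphism $\varphi$ from $\mathcal B$ onto the multiloop algebra and a group isomorphism $\nu:\Lambda\to\mathbb Z^n$ such that $\varphi$ maps $\mathcal B^\lambda$ onto the component of degree $\nu(\lambda)$ for every $\lambda\in\Lambda$. **Theorem.**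 Let $\mathcal B$ be an associative (respectively alternative, Jordan) $\Lambda$-torus. Then $\mathcal B$ has a multiloop realization based on some finite-dimensional simple associative (respectively alternative, Jordan) algebra $\mathcal A$ if and only if $\mathcal B$ is fgc. -/

import Mathlib

open scoped TensorProduct

namespace MultiloopTori

universe u v

/-! Algebras over `k` are neither associative nor unital in general: a `k`-algebra is a
`NonUnitalNonAssocRing` with a `k`-module structure for which the product is bilinear. -/

section Varieties

/-- Associativity. -/
def IsAssociativeAlg (A : Type*) [Mul A] : Prop :=
  ∀ x y z : A, x * y * z = x * (y * z)

/-- The two alternative laws. -/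
def IsAlternativeAlg (A : Type*) [Mul A] : Prop :=
  (∀ x y : A, x * x * y = x * (x * y)) ∧ ∀ x y : A, y * x * x = y * (x * x)

/-- (Linear) Jordan algebras: commutativity and the Jordan identity. -/
def IsJordanAlg (A : Type*) [Mul A] : Prop :=
  (∀ x y : A, x * y = y * x) ∧ ∀ x y : A, x * y * (x * x) = x * (y * (x * x))

/-- Invertibility in a unital associative or alternative algebra. -/
def IsInvertible {B : Type*} [MulOneClass B] (x : B) : Prop :=
  ∃ y : B, x * y = 1 ∧ y * x = 1

/-- Invertibility in a unital Jordan algebra. -/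
def IsJordanInvertible {B : Type*} [MulOneClass B] (x : B) : Prop :=
  ∃ y : B, x * y = 1 ∧ x * x * y = x

end Varieties

section Algebras

variable (k : Type u) [Field k] (A : Type v) [NonUnitalNonAssocRing A] [Module k A]
  [IsScalarTower k A A] [SMulCommClass k A A]

/-- `A` is simple: `AA ≠ 0` and the only (two-sided, `k`-linear) ideals are `0` and `A`. -/
def IsSimpleAlg : Prop :=
  (∃ x y : A, x * y ≠ 0) ∧
    ∀ I : Submodule k A, (∀ x ∈ I, ∀ a : A, a * x ∈ I ∧ x * a ∈ I) → I = ⊥ ∨ I = ⊤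

/-- The multiplication algebra: the unital subalgebra of `End_k(A)` generated by all left and
right multiplications. -/
def multAlgebra : Subalgebra k (Module.End k A) :=
  Algebra.adjoin k
    (Set.range (fun a : A => LinearMap.mulLeft k a) ∪
      Set.range (fun a : A => LinearMap.mulRight k a))

/-- The centroid: the centralizer of the multiplication algebra in `End_k(A)`. -/
def centroid : Subalgebra k (Module.End k A) :=
  Subalgebra.centralizer k (multAlgebra k A : Set (Module.End k A))

/-- `A` is fgc: finitely generated as a module over its centroid (acting by evaluation). -/
def IsFgc : Prop :=
  Module.Finite (centroid k A) A

end Algebras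

section Gradings

variable {k : Type u} [Field k] {Λ : Type*} [AddCommGroup Λ]

/-- The family `𝓑` of subspaces is a `Λ`-grading of the algebra `B`. -/
structure IsGrading {B : Type v} [NonUnitalNonAssocRing B] [Module k B]
    (𝓑 : Λ → Submodule k B) : Prop where
  independent : iSupIndep 𝓑
  iSup_eq_top : ⨆ l, 𝓑 l = ⊤
  mul_mem : ∀ l l' : Λ, ∀ x ∈ 𝓑 l, ∀ y ∈ 𝓑 l', x * y ∈ 𝓑 (l + l')

/-- The support of a family of subspaces. -/
def support {B : Type v} [AddCommGroup B] [Module k B] (𝓑 : Λ → Submodule k B) : Set Λ :=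
  {l | 𝓑 l ≠ ⊥}

/-- The common part of the definition of the three kinds of tori; `Inv` is the notion of
invertibility that belongs to the kind of algebra under consideration. -/
structure IsTorus {B : Type v} [NonAssocRing B] [Module k B]
    (Inv : B → Prop) (𝓑 : Λ → Submodule k B) : Prop where
  isGrading : IsGrading 𝓑
  exists_span : ∀ l ∈ support 𝓑, ∃ x : B, Inv x ∧ 𝓑 l = Submodule.span k {x}
  closure_support : AddSubgroup.closure (support 𝓑) = ⊤

/-- `B` with the family `𝓑` is an associative `Λ`-torus. -/
def IsAssociativeTorus {B : Type v} [NonAssocRing B] [Module k B]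
    (𝓑 : Λ → Submodule k B) : Prop :=
  IsAssociativeAlg B ∧ IsTorus IsInvertible 𝓑

/-- `B` with the family `𝓑` is an alternative `Λ`-torus. -/
def IsAlternativeTorus {B : Type v} [NonAssocRing B] [Module k B]
    (𝓑 : Λ → Submodule k B) : Prop :=
  IsAlternativeAlg B ∧ IsTorus IsInvertible 𝓑

/-- `B` with the family `𝓑` is a Jordan `Λ`-torus. -/
def IsJordanTorus {B : Type v} [NonAssocRing B] [Module k B]
    (𝓑 : Λ → Submodule k B) : Prop :=
  IsJordanAlg B ∧ IsTorus IsJordanInvertible 𝓑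

/-- Graded-isomorphic up to an isomorphism of the grading groups. -/
def IsogradedIsomorphic {Λ' : Type*} [AddCommGroup Λ']
    {B : Type*} [NonUnitalNonAssocSemiring B] [Module k B] (𝓑 : Λ → Submodule k B)
    {B' : Type*} [NonUnitalNonAssocSemiring B'] [Module k B'] (𝓑' : Λ' → Submodule k B') : Prop :=
  ∃ (φ : B ≃ₗ[k] B') (ν : Λ ≃+ Λ'),
    (∀ x y : B, φ (x * y) = φ x * φ y) ∧
      ∀ l : Λ, (𝓑 l).map (φ : B →ₗ[k] B') = 𝓑' (ν l)

end Gradings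

section Multiloop

/-- An `n`-tuple of positive integers `m` and commuting algebra automorphisms `σ 1, …, σ n` of `A`
with `σ i ^ m i = 1`. -/
structure MultiloopDatum (k : Type u) [Field k] (A : Type v) [NonUnitalNonAssocRing A]
    [Module k A] (n : ℕ) where
  m : Fin n → ℕ
  m_pos : ∀ i, 0 < m i
  σ : Fin n → (A ≃ₗ[k] A)
  map_mul : ∀ i, ∀ x y : A, σ i (x * y) = σ i x * σ i y
  commute : ∀ i j, Commute (σ i) (σ j)
  pow_eq_one : ∀ i, σ i ^ m i = 1

/-- The Laurent polynomial algebra in `n` variables; the monomial `z ^ l` is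
`AddMonoidAlgebra.single l 1`. -/
abbrev Laurent (k : Type u) [Field k] (n : ℕ) : Type u := AddMonoidAlgebra k (Fin n → ℤ)

variable {k : Type u} [Field k] {A : Type v} [NonUnitalNonAssocRing A] [Module k A]
  [IsScalarTower k A A] [SMulCommClass k A A] {n : ℕ}

namespace MultiloopDatum

/-- The simultaneous eigenspace `{u | σ j u = ζ_{m j} ^ (l j) u for all j}`. It depends only on
the classes of the `l j` modulo `m j` when `ζ_{m j}` is a root of unity of order `m j`. -/
def eigenspace (D : MultiloopDatum k A n) (ζ : ℕ → kˣ) (l : Fin n → ℤ) : Submodule k A where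
  carrier := {u | ∀ j, D.σ j u = ((ζ (D.m j) ^ l j : kˣ) : k) • u}
  zero_mem' := fun j => by simp
  add_mem' := fun {a b} ha hb j => by rw [map_add, ha j, hb j, smul_add]
  smul_mem' := fun c x hx j => by rw [map_smul, hx j, smul_comm]

/-- The subspace `A^l ⊗ z^l` of `A ⊗ k[z₁^±1, …, zₙ^±1]`. -/
noncomputable def component (D : MultiloopDatum k A n) (ζ : ℕ → kˣ) (l : Fin n → ℤ) :
    Submodule k (A ⊗[k] Laurent k n) :=
  (D.eigenspace ζ l).map
    ((TensorProduct.mk k A (Laurent k n)).flip (AddMonoidAlgebra.single l 1))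

theorem component_mul_mem (D : MultiloopDatum k A n) (ζ : ℕ → kˣ) (l l' : Fin n → ℤ)
    {x y : A ⊗[k] Laurent k n} (hx : x ∈ D.component ζ l) (hy : y ∈ D.component ζ l') :
    x * y ∈ D.component ζ (l + l') := by
  obtain ⟨u, hu, rfl⟩ := hx
  obtain ⟨w, hw, rfl⟩ := hy
  refine ⟨u * w, fun j => ?_, ?_⟩
  · rw [D.map_mul, hu j, hw j, smul_mul_smul_comm, Pi.add_apply, zpow_add, Units.val_mul]
  · simp [LinearMap.flip_apply, TensorProduct.mk_apply, Algebra.TensorProduct.tmul_mul_tmul,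
      AddMonoidAlgebra.single_mul_single]

/-- The multiloop algebra of the datum `D`: the sum of the subspaces `A^l ⊗ z^l`, as a subalgebra
of `A ⊗ k[z₁^±1, …, zₙ^±1]`. -/
noncomputable def algebra (D : MultiloopDatum k A n) (ζ : ℕ → kˣ) :
    NonUnitalSubalgebra k (A ⊗[k] Laurent k n) where
  __ := (⨆ l, D.component ζ l : Submodule k (A ⊗[k] Laurent k n))
  mul_mem' := by
    intro x y hx hy
    change x ∈ (⨆ l, D.component ζ l : Submodule k (A ⊗[k] Laurent k n)) at hx
    change y ∈ (⨆ l, D.component ζ l : Submodule k (A ⊗[k] Laurent k n)) at hy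
    change x * y ∈ (⨆ l, D.component ζ l : Submodule k (A ⊗[k] Laurent k n))
    induction hx using Submodule.iSup_induction' with
    | zero => simp
    | add a b _ _ ha hb => rw [add_mul]; exact add_mem ha hb
    | mem l a ha =>
      induction hy using Submodule.iSup_induction' with
      | zero => simp
      | add c d _ _ hc hd => rw [mul_add]; exact add_mem hc hd
      | mem l' c hc => exact Submodule.mem_iSup_of_mem (l + l') (D.component_mul_mem ζ l l' ha hc)

/-- The `ℤⁿ`-grading of the multiloop algebra: the component of degree `l` is `A^l ⊗ z^l`. -/
noncomputable def grading (D : MultiloopDatum k A n) (ζ : ℕ → kˣ) (l : Fin n → ℤ) :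
    Submodule k (D.algebra ζ) :=
  (D.component ζ l).comap (NonUnitalSubalgebra.toSubmodule (D.algebra ζ)).subtype

end MultiloopDatum

/-- The `Λ`-graded algebra `B` has a multiloop realization based on `A` (with `n` automorphisms,
relative to the roots of unity `ζ`). -/
def HasMultiloopRealization (ζ : ℕ → kˣ) (n : ℕ) {Λ : Type*} [AddCommGroup Λ]
    {B : Type*} [NonUnitalNonAssocRing B] [Module k B] (𝓑 : Λ → Submodule k B)
    (A : Type v) [NonUnitalNonAssocRing A] [Module k A]
    [IsScalarTower k A A] [SMulCommClass k A A] : Prop :=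
  ∃ D : MultiloopDatum k A n, IsogradedIsomorphic 𝓑 (D.grading ζ)

/-- `B` has a multiloop realization based on some finite dimensional simple algebra that belongs to
the class `P` of algebras. The algebra `A` is looked for in the universe of `B`; as it
is a homomorphic image of `B`, this is no restriction. -/
def HasSimpleMultiloopRealization (P : ∀ (A : Type v) [Mul A], Prop) (ζ : ℕ → kˣ) (n : ℕ)
    {Λ : Type*} [AddCommGroup Λ] {B : Type v} [NonUnitalNonAssocRing B] [Module k B]
    (𝓑 : Λ → Submodule k B) : Prop :=
  ∃ (A : Type v) (_ : NonUnitalNonAssocRing A) (_ : Module k A)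
    (_ : IsScalarTower k A A) (_ : SMulCommClass k A A),
    FiniteDimensional k A ∧ IsSimpleAlg k A ∧ P A ∧ HasMultiloopRealization ζ n 𝓑 A

end Multiloop

end MultiloopTori

/-! Suppose `B` is a multiloop algebra. Multiplication by z^p with m_i ∣ p_i for all i preserves it
and lies in the centroid. Such shifts move every degree into the finite box 0 ≤ q_i < m_i, and the
components of a torus are at most one-dimensional, so finitely many elements generate `B`
(`HasMultiloopRealization.isFgc`).

Conversely, let `B` be fgc and let Γ be the group of degrees of nonzero homogeneous central
elements. As `B` is unital, its centroid acts by central elements, whose homogeneous components are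
again central; finite generation therefore confines the support to finitely many cosets of Γ
(`IsGrading.exists_finset_of_isFgc`). Powers of invertible elements do not vanish, so the support
contains all multiples of its elements, and the pigeonhole principle makes Λ/Γ torsion
(`IsTorus.exists_nsmul_mem`). The nonvanishing of powers rests on the Moufang identity or on the
linearized Jordan identity. Beyond it, the variety matters only through its closure under images.

Since Γ is free, central z_g of degree g can be chosen with z_{g+g'} = z_g z_{g'}
(`IsTorus.nonempty_centralSection`). Setting every z_g to 1 gives an algebra A
(`CentralSection.Fiber`). It is finite-dimensional because finitely many cosets occur, simple by a
shortest-element argument (`CentralSection.one_mem_of_ideal`), and in the same variety because it is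
an image of `B`. A Smith basis of Λ adapted to Γ supplies the m_i, and the characters l ↦
ζ_{m_i}^{l_i}, with common kernel Γ, act on A as the required automorphisms. Sending x of degree l
to its class tensored with z^l identifies `B` with the multiloop algebra
(`CentralSection.hasMultiloopRealization`). -/

namespace MultiloopTori

/-! ### Homogeneous components and linear maps on graded spaces -/

section GradingTools

variable {k : Type*} [Field k] {Λ : Type*} [AddCommGroup Λ]
  {B : Type*} [NonUnitalNonAssocRing B] [Module k B] {𝓑 : Λ → Submodule k B}

open Classical in
/-- The decomposition of an element into its homogeneous components. -/
noncomputable def IsGrading.decomp (h : IsGrading 𝓑) : B ≃ₗ[k] DirectSum Λ (fun l => 𝓑 l) :=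
  letI := ((DirectSum.isInternal_submodule_iff_iSupIndep_and_iSup_eq_top 𝓑).2
    ⟨h.independent, h.iSup_eq_top⟩).chooseDecomposition
  DirectSum.decomposeLinearEquiv 𝓑

open Classical in
theorem IsGrading.decomp_of_mem (h : IsGrading 𝓑) {l : Λ} {x : B} (hx : x ∈ 𝓑 l) :
    h.decomp x = DirectSum.lof k Λ (fun l => 𝓑 l) l ⟨x, hx⟩ :=
  letI := ((DirectSum.isInternal_submodule_iff_iSupIndep_and_iSup_eq_top 𝓑).2
    ⟨h.independent, h.iSup_eq_top⟩).chooseDecomposition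
  DirectSum.decompose_of_mem 𝓑 hx

open Classical in
/-- The linear map that agrees with `f l` on the component of degree `l`. -/
noncomputable def IsGrading.lift (h : IsGrading 𝓑) {M : Type*} [AddCommGroup M] [Module k M]
    (f : Λ → B →ₗ[k] M) : B →ₗ[k] M :=
  DirectSum.toModule k Λ M (fun l => f l ∘ₗ (𝓑 l).subtype) ∘ₗ h.decomp.toLinearMap

theorem IsGrading.lift_of_mem (h : IsGrading 𝓑) {M : Type*} [AddCommGroup M] [Module k M]
    (f : Λ → B →ₗ[k] M) {l : Λ} {x : B} (hx : x ∈ 𝓑 l) : h.lift f x = f l x := by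
  classical
  simp [IsGrading.lift, h.decomp_of_mem hx]

/-- The projection onto the component of degree `l`. -/
noncomputable def IsGrading.proj (h : IsGrading 𝓑) (l : Λ) : B →ₗ[k] B :=
  (𝓑 l).subtype ∘ₗ DirectSum.component k Λ (fun l => 𝓑 l) l ∘ₗ h.decomp.toLinearMap

theorem IsGrading.proj_mem (h : IsGrading 𝓑) (l : Λ) (x : B) : h.proj l x ∈ 𝓑 l := by
  simp [IsGrading.proj]

theorem IsGrading.proj_of_mem (h : IsGrading 𝓑) {l : Λ} {x : B} (hx : x ∈ 𝓑 l) :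
    h.proj l x = x := by
  classical
  simp [IsGrading.proj, h.decomp_of_mem hx]

theorem IsGrading.proj_of_mem_ne (h : IsGrading 𝓑) {l l' : Λ} {x : B} (hx : x ∈ 𝓑 l)
    (hl : l ≠ l') : h.proj l' x = 0 := by
  classical
  simp [IsGrading.proj, h.decomp_of_mem hx, DirectSum.component.of, hl]

@[elab_as_elim]
theorem IsGrading.induction (h : IsGrading 𝓑) {motive : B → Prop} (zero : motive 0)
    (mem : ∀ l, ∀ x ∈ 𝓑 l, motive x) (add : ∀ x y, motive x → motive y → motive (x + y))
    (x : B) : motive x :=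
  Submodule.iSup_induction 𝓑 (motive := motive) (h.iSup_eq_top ▸ Submodule.mem_top) mem zero add

theorem IsGrading.hom_ext (h : IsGrading 𝓑) {M : Type*} [AddCommGroup M] [Module k M]
    {f g : B →ₗ[k] M} (hfg : ∀ l, ∀ x ∈ 𝓑 l, f x = g x) : f = g := by
  ext x
  induction x using h.induction with
  | zero => simp
  | mem l x hx => exact hfg l x hx
  | add x y hx hy => rw [map_add, map_add, hx, hy]

/-- The degrees in which an element has a nonzero component. -/
noncomputable def IsGrading.supp (h : IsGrading 𝓑) (x : B) : Finset Λ := by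
  classical exact DFinsupp.support (h.decomp x)

theorem IsGrading.mem_supp (h : IsGrading 𝓑) {x : B} {l : Λ} :
    l ∈ h.supp x ↔ h.proj l x ≠ 0 := by
  classical
  simp only [IsGrading.supp, DFinsupp.mem_support_toFun, IsGrading.proj, ne_eq]
  exact not_congr (Submodule.coe_eq_zero.symm)

theorem IsGrading.sum_proj (h : IsGrading 𝓑) (x : B) : ∑ l ∈ h.supp x, h.proj l x = x := by
  classical
  let := ((DirectSum.isInternal_submodule_iff_iSupIndep_and_iSup_eq_top 𝓑).2
    ⟨h.independent, h.iSup_eq_top⟩).chooseDecomposition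
  exact DirectSum.sum_support_decompose 𝓑 x

theorem IsGrading.ext_proj (h : IsGrading 𝓑) {x y : B} (hxy : ∀ l, h.proj l x = h.proj l y) :
    x = y := by
  rw [← sub_eq_zero, ← h.sum_proj (x - y)]
  exact Finset.sum_eq_zero fun l _ => by rw [map_sub, hxy, sub_self]

/-- A linear map that shifts degrees through `f` commutes with projections. -/
theorem IsGrading.proj_map (h : IsGrading 𝓑) {f : Λ → Λ} (hf : f.Injective) {E : B →ₗ[k] B}
    (hE : ∀ l, ∀ x ∈ 𝓑 l, E x ∈ 𝓑 (f l)) (l : Λ) (x : B) :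
    h.proj (f l) (E x) = E (h.proj l x) := by
  induction x using h.induction with
  | zero => simp
  | mem l' x hx =>
    by_cases hl : l' = l
    · subst hl
      rw [h.proj_of_mem hx, h.proj_of_mem (hE _ _ hx)]
    · rw [h.proj_of_mem_ne hx hl, map_zero, h.proj_of_mem_ne (hE _ _ hx) (fun e => hl (hf e))]
  | add x y hx hy => simp only [map_add, hx, hy]

theorem IsGrading.proj_shift (h : IsGrading 𝓑) {d : Λ} {E : B →ₗ[k] B}
    (hE : ∀ l, ∀ x ∈ 𝓑 l, E x ∈ 𝓑 (l + d)) (l : Λ) (x : B) :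
    h.proj (l + d) (E x) = E (h.proj l x) :=
  h.proj_map (add_left_injective d) hE l x

end GradingTools

/-- Comparing degree l parts in x * 1 = x shows that the degree 0 part of 1 is a right identity, so
it equals 1. -/
theorem IsGrading.one_mem {k : Type*} [Field k] {Λ : Type*} [AddCommGroup Λ]
    {B : Type*} [NonAssocRing B] [Module k B] [IsScalarTower k B B] [SMulCommClass k B B]
    {𝓑 : Λ → Submodule k B} (h : IsGrading 𝓑) : (1 : B) ∈ 𝓑 0 := by
  have key : LinearMap.mulRight k (h.proj 0 (1 : B)) = LinearMap.id := by
    refine h.hom_ext fun l x hx => ?_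
    have := h.proj_map (f := fun d => l + d) (add_right_injective l)
      (E := LinearMap.mulLeft k x) (fun d y hy => h.mul_mem l d x hx y hy) 0 1
    simpa [h.proj_of_mem hx] using this.symm
  have := LinearMap.congr_fun key 1
  simp only [LinearMap.mulRight_apply, one_mul, LinearMap.id_apply] at this
  exact this ▸ h.proj_mem 0 1

/-! ### Powers of invertible elements do not vanish -/

section Powers

/-- The left power `x (x (… x))`. -/
def leftPow {B : Type*} [MulOneClass B] (x : B) : ℕ → B
  | 0 => 1
  | n + 1 => x * leftPow x n

theorem leftPow_mem {k : Type*} [Field k] {Λ : Type*} [AddCommGroup Λ]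
    {B : Type*} [NonAssocRing B] [Module k B] [IsScalarTower k B B] [SMulCommClass k B B]
    {𝓑 : Λ → Submodule k B} (h : IsGrading 𝓑) {l : Λ} {x : B} (hx : x ∈ 𝓑 l) (n : ℕ) :
    leftPow x n ∈ 𝓑 (n • l) := by
  induction n with
  | zero => simpa [leftPow] using h.one_mem
  | succ n ih =>
    rw [succ_nsmul']
    exact h.mul_mem _ _ _ hx _ ih

theorem IsAssociativeAlg.isAlternativeAlg {B : Type*} [Mul B] (h : IsAssociativeAlg B) :
    IsAlternativeAlg B :=
  ⟨fun x y => h x x y, fun x y => h y x x⟩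

/-- The left Moufang identity. -/
theorem IsAlternativeAlg.moufang {B : Type*} [NonUnitalNonAssocRing B] (h : IsAlternativeAlg B)
    (h2 : ∀ x : B, 2 • x = 0 → x = 0) (a b c : B) : a * (b * (a * c)) = a * b * a * c := by
  have s12 : ∀ x y z : B, associator x y z = -associator y x z := fun x y z => by
    have := h.1 (x + y) z
    simp only [add_mul, mul_add, h.1] at this
    rw [← sub_eq_zero] at this ⊢
    rw [← this, associator_apply, associator_apply]
    abel
  have s23 : ∀ x y z : B, associator x y z = -associator x z y := fun x y z => by
    have := h.2 (y + z) x
    simp only [add_mul, mul_add, h.2] at this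
    rw [← sub_eq_zero] at this ⊢
    rw [← this, associator_apply, associator_apply]
    abel
  have z12 : ∀ x y : B, associator x x y = 0 := fun x y => sub_eq_zero.2 (h.1 x y)
  have z23 : ∀ x y : B, associator y x x = 0 := fun x y => sub_eq_zero.2 (h.2 x y)
  have z13 : ∀ x y : B, associator x y x = 0 := fun x y => by rw [s12, z23, neg_zero]
  have c1 := associator_cocycle a a b c
  have c2 := associator_cocycle b a a c
  have c3 := associator_cocycle a b a c
  simp only [z12, z13, z23, mul_zero, zero_mul, add_zero, sub_zero, zero_sub] at c1 c2 c3
  rw [s12 a (a * b) c] at c1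
  rw [s12 b (a * a) c, s12 b a (a * c)] at c2
  rw [s12 b a c, mul_neg, s12 a (b * a) c] at c3
  -- The combination `c2 - c3 - c1` of the cocycle relations is twice this sum.
  have key : associator (a * b) a c + associator a b (a * c) = 0 := by
    refine h2 _ (Eq.trans ?_ (congrArg₂ (· - ·) (congrArg₂ (· - ·) c2 c3) c1) |>.trans (by simp))
    abel
  rw [associator_apply, associator_apply, sub_add_sub_cancel, sub_eq_zero] at key
  exact key.symm

/-- Left multiplication by x is injective. If xw = 0, linearized left alternativity gives x(yw) =
2w, and the Moufang identity gives y(x(yw)) = ((yx)y)w = yw. Hence 2yw = yw, so yw = 0 and then 2w =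
0. -/
theorem IsAlternativeAlg.leftPow_ne_zero {B : Type*} [NonAssocRing B] [Nontrivial B]
    (h : IsAlternativeAlg B) (h2 : ∀ x : B, 2 • x = 0 → x = 0) {x : B} (hx : IsInvertible x)
    (n : ℕ) : leftPow x n ≠ 0 := by
  obtain ⟨y, hxy, hyx⟩ := hx
  have inj : ∀ w, x * w = 0 → w = 0 := fun w hw => by
    have e1 : x * (y * w) = 2 • w := by
      have := h.1 (x + y) w
      simp only [add_mul, mul_add, h.1, hxy, hyx, hw, one_mul, mul_zero] at this
      rw [← sub_eq_zero] at this ⊢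
      rw [← neg_eq_zero, ← this]
      abel
    have e2 : y * w = 0 := by
      have := h.moufang h2 y x w
      rw [hyx, one_mul, e1, mul_smul_comm, two_nsmul, add_eq_left] at this
      exact this
    exact h2 _ (by rw [← e1, e2, mul_zero])
  induction n with
  | zero => exact one_ne_zero
  | succ n ih => exact fun h0 => ih (inj _ h0)

theorem IsJordanAlg.linearized {B : Type*} [NonUnitalNonAssocRing B] (h : IsJordanAlg B)
    (h2 : ∀ x : B, 2 • x = 0 → x = 0) (a b c d : B) :
    a * (b * c * d) - b * c * (a * d) + (b * (c * a * d) - c * a * (b * d)) +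
      (c * (a * b * d) - a * b * (c * d)) = 0 := by
  let : NonUnitalNonAssocCommRing B := { ‹NonUnitalNonAssocRing B› with mul_comm := h.1 }
  have : IsCommJordan B := ⟨h.2⟩
  have := DFunLike.congr_fun (two_nsmul_lie_lmul_lmul_add_add_eq_zero a b c) d
  exact h2 _ this

/-- Multiplication by y lowers powers of x by one, so a vanishing power would force 1 = 0. Left
multiplication by x itself need not be injective here. -/
theorem IsJordanAlg.leftPow_ne_zero {B : Type*} [NonAssocRing B] [Nontrivial B]
    (h : IsJordanAlg B) (h2 : ∀ x : B, 2 • x = 0 → x = 0) {x : B} (hx : IsJordanInvertible x)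
    (n : ℕ) : leftPow x n ≠ 0 := by
  obtain ⟨y, hxy, hxxy⟩ := hx
  have comm := h.1
  have hp : ∀ n, x * x * leftPow x n = leftPow x (n + 2) := fun n => by
    induction n with
    | zero => simp [leftPow]
    | succ n ih =>
      change x * x * (x * leftPow x n) = x * leftPow x (n + 2)
      rw [← ih, comm (x * x) (x * _), h.2, comm (leftPow x n)]
  -- Two consecutive cases are carried: the linearized identity at (y, x^{n+1}, x, x) obtains
  -- x^{n+3}y from x^{n+1}y.
  have hy : ∀ n, leftPow x (n + 1) * y = leftPow x n ∧
      leftPow x (n + 2) * y = leftPow x (n + 1) := by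
    intro n
    induction n with
    | zero => simp [leftPow, hxy, hxxy]
    | succ n ih =>
      refine ⟨ih.2, ?_⟩
      have key := h.linearized h2 y (leftPow x (n + 1)) x x
      have e : ∀ m, leftPow x m * x = leftPow x (m + 1) := fun m => comm _ _
      rw [e, e, comm y x, hxy, mul_one, one_mul, one_mul, e, comm y (leftPow x (n + 1)), ih.1, e,
        comm _ (x * x), hp, comm y] at key
      change _ - _ + (_ - _) + (leftPow x (n + 2) - _) = 0 at key
      rwa [sub_self, add_zero, add_zero, sub_eq_zero] at key
  induction n with
  | zero => exact one_ne_zero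
  | succ n ih => exact fun h0 => ih (by rw [← (hy n).1, h0, zero_mul])

end Powers

end MultiloopTori

namespace MultiloopTori

/-! ### Homogeneous central elements and the centroid -/

section Center

variable {k : Type*} [Field k] {Λ : Type*} [AddCommGroup Λ]
  {B : Type*} [NonAssocRing B] [Module k B] [IsScalarTower k B B] [SMulCommClass k B B]
  {𝓑 : Λ → Submodule k B}

/-- The degree -l component of any right inverse of a degree l element is already a right inverse.
-/
theorem IsTorus.exists_mul_eq_one {Inv : B → Prop} (h : IsTorus Inv 𝓑)
    (hInv : ∀ x, Inv x → ∃ y, x * y = 1) {l : Λ} {x : B} (hx : x ∈ 𝓑 l) (hx0 : x ≠ 0) :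
    ∃ y ∈ 𝓑 (-l), x * y = 1 := by
  have hl : l ∈ support 𝓑 := fun e => hx0 (by rwa [e, Submodule.mem_bot] at hx)
  obtain ⟨x₀, hi, hs⟩ := h.exists_span l hl
  obtain ⟨y₀, hy₀⟩ := hInv x₀ hi
  obtain ⟨c, rfl⟩ := Submodule.mem_span_singleton.1 (hs ▸ hx)
  have hc : c ≠ 0 := fun e => hx0 (by rw [e, zero_smul])
  have hx₀ : x₀ ∈ 𝓑 l := hs ▸ Submodule.mem_span_singleton_self x₀
  refine ⟨c⁻¹ • h.isGrading.proj (-l) y₀, Submodule.smul_mem _ _ (h.isGrading.proj_mem _ _), ?_⟩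
  have := h.isGrading.proj_map (f := fun d => l + d) (add_right_injective l)
    (E := LinearMap.mulLeft k x₀) (fun d y hy => h.isGrading.mul_mem l d x₀ hx₀ y hy) (-l) y₀
  simp only [LinearMap.mulLeft_apply, hy₀, add_neg_cancel,
    h.isGrading.proj_of_mem h.isGrading.one_mem] at this
  rw [smul_mul_smul_comm, mul_inv_cancel₀ hc, one_smul, this]

/-- To check that an element is central, homogeneous test elements suffice. -/
theorem IsGrading.isMulCentral (h : IsGrading 𝓑) {z : B}
    (hc : ∀ l, ∀ a ∈ 𝓑 l, z * a = a * z)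
    (hl : ∀ l l', ∀ a ∈ 𝓑 l, ∀ b ∈ 𝓑 l', z * (a * b) = z * a * b)
    (hr : ∀ l l', ∀ a ∈ 𝓑 l, ∀ b ∈ 𝓑 l', a * b * z = a * (b * z)) : IsMulCentral z where
  comm a := LinearMap.congr_fun
    (h.hom_ext (f := LinearMap.mulLeft k z) (g := LinearMap.mulRight k z) hc) a
  left_assoc a b := by
    induction a using h.induction with
    | zero => simp
    | add x y hx hy => simp only [mul_add, add_mul, hx, hy]
    | mem l a ha =>
      induction b using h.induction with
      | zero => simp
      | add x y hx hy => simp only [mul_add, hx, hy]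
      | mem l' b hb => exact hl l l' a ha b hb
  right_assoc a b := by
    induction a using h.induction with
    | zero => simp
    | add x y hx hy => simp only [add_mul, hx, hy]
    | mem l a ha =>
      induction b using h.induction with
      | zero => simp
      | add x y hx hy => simp only [mul_add, add_mul, hx, hy]
      | mem l' b hb => exact hr l l' a ha b hb

/-- Against homogeneous test elements, each centrality law equates two operators of the same degree
applied to z, so it can be read off component by component. -/
theorem IsGrading.isMulCentral_proj (h : IsGrading 𝓑) {z : B} (hz : IsMulCentral z) (d : Λ) :
    IsMulCentral (h.proj d z) := by
  have key : ∀ (m : Λ) (E E' : B →ₗ[k] B), (∀ l, ∀ x ∈ 𝓑 l, E x ∈ 𝓑 (l + m)) →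
      (∀ l, ∀ x ∈ 𝓑 l, E' x ∈ 𝓑 (l + m)) → E z = E' z → E (h.proj d z) = E' (h.proj d z) :=
    fun m E E' hE hE' e => by rw [← h.proj_shift hE, ← h.proj_shift hE', e]
  refine h.isMulCentral (fun l a ha => ?_) (fun l l' a ha b hb => ?_) (fun l l' a ha b hb => ?_)
  · exact key l (LinearMap.mulRight k a) (LinearMap.mulLeft k a)
      (fun m x hx => h.mul_mem _ _ _ hx _ ha)
      (fun m x hx => add_comm l m ▸ h.mul_mem _ _ _ ha _ hx) (hz.comm a)
  · exact key (l + l') (LinearMap.mulRight k (a * b))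
      (LinearMap.mulRight k b ∘ₗ LinearMap.mulRight k a)
      (fun m x hx => h.mul_mem _ _ _ hx _ (h.mul_mem _ _ _ ha _ hb))
      (fun m x hx => add_assoc m l l' ▸ h.mul_mem _ _ _ (h.mul_mem _ _ _ hx _ ha) _ hb)
      (hz.left_assoc a b)
  · exact key (l + l') (LinearMap.mulLeft k (a * b))
      (LinearMap.mulLeft k a ∘ₗ LinearMap.mulLeft k b)
      (fun m x hx => add_comm (l + l') m ▸ h.mul_mem _ _ _ (h.mul_mem _ _ _ ha _ hb) _ hx)
      (fun m x hx => by
        have := h.mul_mem _ _ _ ha _ (h.mul_mem _ _ _ hb _ hx)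
        rwa [← add_assoc, add_comm] at this)
      (hz.right_assoc a b)

theorem _root_.IsMulCentral.mul_left_comm {M : Type*} [Mul M] {z : M} (hz : IsMulCentral z)
    (a b : M) : a * (z * b) = z * (a * b) := by
  rw [(hz.comm b).eq, ← hz.right_assoc, (hz.comm (a * b)).eq]

/-- A right inverse of a central element is central. -/
theorem _root_.IsMulCentral.of_mul_eq_one {M : Type*} [MulOneClass M] {z y : M}
    (hz : IsMulCentral z) (h : z * y = 1) : IsMulCentral y := by
  have inj : ∀ a b, z * a = z * b → a = b := fun a b e => by
    have := congrArg (y * ·) e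
    simpa only [hz.mul_left_comm, hz.left_assoc, h, one_mul] using this
  refine ⟨fun a => inj _ _ ?_, fun a b => inj _ _ ?_, fun a b => inj _ _ ?_⟩
  · rw [hz.left_assoc, h, one_mul, ← hz.mul_left_comm, h, mul_one]
  · rw [hz.left_assoc, h, one_mul, hz.left_assoc, hz.left_assoc, h, one_mul]
  · rw [← hz.mul_left_comm, h, mul_one, ← hz.mul_left_comm, ← hz.mul_left_comm, h, mul_one]

/-- A group of degrees of central homogeneous elements, together with a multiplicative choice of
central elements in these degrees; the group contains all degrees of central elements. -/
structure CentralSection (𝓑 : Λ → Submodule k B) where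
  Γ : Submodule ℤ Λ
  z : Γ → B
  mem : ∀ g : Γ, z g ∈ 𝓑 (g : Λ)
  central : ∀ g, IsMulCentral (z g)
  zero : z 0 = 1
  add : ∀ g g', z (g + g') = z g * z g'
  maximal : ∀ l, ∀ x ∈ 𝓑 l, x ≠ 0 → IsMulCentral x → l ∈ Γ

/-- The pairs (degree, central unit of that degree) form a group `H`. Its projection to Λ has image
a subgroup of a free abelian group, hence projective, so the projection splits; the splitting is the
multiplicative choice. -/
theorem IsTorus.nonempty_centralSection [Nontrivial B] [Module.Free ℤ Λ] [Module.Finite ℤ Λ]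
    {Inv : B → Prop} (h : IsTorus Inv 𝓑) (hInv : ∀ x, Inv x → ∃ y, x * y = 1) :
    Nonempty (CentralSection 𝓑) := by
  let _ : CommSemiring (Subsemiring.center B) := Subsemiring.center.commSemiring' B
  let Z := Subsemiring.center B
  let H : AddSubgroup (Λ × Additive Zˣ) :=
    { carrier := {p | ((p.2.toMul : Z) : B) ∈ 𝓑 p.1}
      zero_mem' := h.isGrading.one_mem
      add_mem' := fun {p q} hp hq => h.isGrading.mul_mem _ _ _ hp _ hq
      neg_mem' := fun {p} hp => by
        have h0 : ((p.2.toMul : Z) : B) ≠ 0 := fun e => by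
          have := congrArg Subtype.val (p.2.toMul.mul_inv)
          change ((p.2.toMul : Z) : B) * _ = 1 at this
          rw [e, zero_mul] at this
          exact zero_ne_one this
        obtain ⟨y, hy, hxy⟩ := h.exists_mul_eq_one hInv hp h0
        have hc : IsMulCentral (((p.2.toMul)⁻¹ : Zˣ) : Z).1 := (((p.2.toMul)⁻¹ : Zˣ) : Z).2
        have h1 : (((p.2.toMul)⁻¹ : Zˣ) : Z).1 * (p.2.toMul : Z).1 = 1 :=
          congrArg Subtype.val (p.2.toMul.inv_mul)
        have : (((p.2.toMul)⁻¹ : Zˣ) : Z).1 = y := by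
          rw [← mul_one (((p.2.toMul)⁻¹ : Zˣ) : Z).1, ← hxy, hc.left_assoc, h1, one_mul]
        change (((p.2.toMul)⁻¹ : Zˣ) : Z).1 ∈ 𝓑 (-p.1)
        rwa [this] }
  let f : H →ₗ[ℤ] Λ := ((AddMonoidHom.fst _ _).comp H.subtype).toIntLinearMap
  obtain ⟨g, hg⟩ := Module.projective_lifting_property f.rangeRestrict LinearMap.id
    f.surjective_rangeRestrict
  have hg' : ∀ x : LinearMap.range f, (g x).1.1 = (x : Λ) := fun x =>
    congrArg Subtype.val (LinearMap.congr_fun hg x)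
  refine ⟨⟨LinearMap.range f, fun x => (((g x).1.2.toMul : Zˣ) : Z).1, fun x => ?_,
    fun x => (((g x).1.2.toMul : Zˣ) : Z).2, ?_, fun x y => ?_, fun l x hx hx0 hc => ?_⟩⟩
  · have := (g x).2
    rwa [← hg' x]
  · rw [map_zero]; rfl
  · rw [map_add]; rfl
  · obtain ⟨y, hy, hxy⟩ := h.exists_mul_eq_one hInv hx hx0
    have hyc := hc.of_mul_eq_one hxy
    let u : Zˣ := ⟨⟨x, hc⟩, ⟨y, hyc⟩, Subtype.ext hxy,
      Subtype.ext (((hc.comm y).eq.symm.trans hxy : y * x = 1))⟩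
    exact ⟨⟨(l, Additive.ofMul u), hx⟩, rfl⟩

/-- An element of the centroid is the multiplication by a central element. -/
theorem centroid_apply {c : Module.End k B} (hc : c ∈ centroid k B) :
    IsMulCentral (c 1) ∧ ∀ b, c b = c 1 * b := by
  have hl : ∀ a b, c (a * b) = a * c b := fun a b => by
    have := (Subalgebra.mem_centralizer_iff k).1 hc (LinearMap.mulLeft k a)
      (Algebra.subset_adjoin (Or.inl ⟨a, rfl⟩))
    exact (LinearMap.congr_fun this b).symm
  have hr : ∀ a b, c (a * b) = c a * b := fun a b => by
    have := (Subalgebra.mem_centralizer_iff k).1 hc (LinearMap.mulRight k b)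
      (Algebra.subset_adjoin (Or.inr ⟨b, rfl⟩))
    exact (LinearMap.congr_fun this a).symm
  have hb : ∀ b, c b = c 1 * b := fun b => by rw [← hr, one_mul]
  have hb' : ∀ b, c b = b * c 1 := fun b => by rw [← hl, mul_one]
  exact ⟨⟨fun a => (hb a).symm.trans (hb' a), fun a b => by rw [← hb, hr, hb a],
    fun a b => by rw [← hb', hl, hb' b]⟩, hb⟩

/-- The centroid multiplies by central elements, whose components have degrees in Γ. Degrees of
combinations of the generators thus lie in Γ plus the degrees of the generators. -/
theorem IsGrading.exists_finset_of_isFgc (h : IsGrading 𝓑) (C : CentralSection 𝓑)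
    (hf : IsFgc k B) : ∃ F : Finset Λ, ∀ l ∈ support 𝓑, ∃ f ∈ F, l - f ∈ C.Γ := by
  classical
  obtain ⟨S, hS⟩ := hf.fg_top
  refine ⟨S.biUnion h.supp, fun l hl => ?_⟩
  obtain ⟨x, hx, hx0⟩ := Submodule.exists_mem_ne_zero_of_ne_bot hl
  have key : ∀ b : B, ∀ l, h.proj l b ≠ 0 → ∃ f ∈ S.biUnion h.supp, l - f ∈ C.Γ := by
    intro b
    have hb : b ∈ Submodule.span (centroid k B) (S : Set B) := hS ▸ Submodule.mem_top
    induction hb using Submodule.span_induction with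
    | mem b hb =>
      exact fun l hl => ⟨l, Finset.mem_biUnion.2 ⟨b, hb, h.mem_supp.2 hl⟩, by simp⟩
    | zero => simp
    | add a b _ _ ha hb =>
      intro l hl
      by_cases h0 : h.proj l a = 0
      · exact hb l (by rwa [map_add, h0, zero_add] at hl)
      · exact ha l h0
    | smul c b _ hb =>
      intro l hl
      obtain ⟨hc, hcb⟩ := centroid_apply c.2
      change h.proj l (c.1 b) ≠ 0 at hl
      rw [hcb, ← h.sum_proj (c.1 1), ← h.sum_proj b, Finset.sum_mul_sum, map_sum] at hl
      obtain ⟨m, hm, hl⟩ := Finset.exists_ne_zero_of_sum_ne_zero hl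
      rw [map_sum] at hl
      obtain ⟨m', hm', hl⟩ := Finset.exists_ne_zero_of_sum_ne_zero hl
      have hmm : m + m' = l := by
        by_contra hne
        exact hl (h.proj_of_mem_ne (h.mul_mem _ _ _ (h.proj_mem _ _) _ (h.proj_mem _ _)) hne)
      obtain ⟨f, hf, hfm⟩ := hb m' (h.mem_supp.1 hm')
      refine ⟨f, hf, ?_⟩
      rw [← hmm, add_sub_assoc]
      exact add_mem (C.maximal m _ (h.proj_mem _ _) (h.mem_supp.1 hm)
        (h.isMulCentral_proj hc m)) hfm
  exact key x l (by rwa [h.proj_of_mem hx])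

/-- For l in the support all multiples of l meet finitely many cosets of Γ, so two of them are
congruent. The support generates Λ, which extends this to every l. -/
theorem IsTorus.exists_nsmul_mem {Inv : B → Prop} (h : IsTorus Inv 𝓑) (C : CentralSection 𝓑)
    (hpow : ∀ l ∈ support 𝓑, ∀ n : ℕ, n • l ∈ support 𝓑) (hf : IsFgc k B) (l : Λ) :
    ∃ n : ℕ, 0 < n ∧ n • l ∈ C.Γ := by
  obtain ⟨F, hF⟩ := h.isGrading.exists_finset_of_isFgc C hf
  have hl : l ∈ AddSubgroup.closure (support 𝓑) := h.closure_support ▸ AddSubgroup.mem_top l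
  induction hl using AddSubgroup.closure_induction with
  | mem l hl =>
    choose f hfF hf using fun n : ℕ => hF _ (hpow l hl n)
    obtain ⟨a, b, hab, e⟩ := Finite.exists_ne_map_eq_of_infinite (fun n => (⟨f n, hfF n⟩ : F))
    have e : f a = f b := congrArg Subtype.val e
    have key : ∀ a b : ℕ, a < b → f a = f b → ∃ n : ℕ, 0 < n ∧ n • l ∈ C.Γ := fun a b hab e => by
      refine ⟨b - a, Nat.sub_pos_of_lt hab, ?_⟩
      have := sub_mem (hf b) (hf a)
      rwa [e, sub_sub_sub_cancel_right, sub_eq_add_neg, ← sub_nsmul _ hab.le] at this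
    rcases hab.lt_or_gt with hab | hab
    · exact key a b hab e
    · exact key b a hab e.symm
  | zero => exact ⟨1, one_pos, by simp⟩
  | add x y _ _ hx hy =>
    obtain ⟨n, hn, hnx⟩ := hx
    obtain ⟨m, hm, hmy⟩ := hy
    refine ⟨m * n, mul_pos hm hn, ?_⟩
    rw [nsmul_add, mul_nsmul' x, mul_nsmul y]
    exact add_mem (nsmul_mem hnx _) (nsmul_mem hmy _)
  | neg x _ hx =>
    obtain ⟨n, hn, hnx⟩ := hx
    exact ⟨n, hn, by rw [smul_neg]; exact neg_mem hnx⟩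

end Center

end MultiloopTori

namespace MultiloopTori

/-! ### Specializing the central elements z_g to 1 -/

section Specialization

set_option linter.unusedSectionVars false

variable {k : Type*} [Field k] {Λ : Type*} [AddCommGroup Λ]
  {B : Type*} [NonAssocRing B] [Module k B] {𝓑 : Λ → Submodule k B}

namespace CentralSection

/-- A representative of the coset of a degree modulo the central degrees. -/
noncomputable def rep (C : CentralSection 𝓑) (l : Λ) : Λ :=
  (Submodule.Quotient.mk l : Λ ⧸ C.Γ).out

theorem rep_sub_mem (C : CentralSection 𝓑) (l : Λ) : C.rep l - l ∈ C.Γ :=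
  (Submodule.Quotient.eq C.Γ).1 (Quotient.out_eq _)

theorem rep_eq_iff (C : CentralSection 𝓑) {l m : Λ} : C.rep l = C.rep m ↔ l - m ∈ C.Γ :=
  (Quotient.out_inj (x := (Submodule.Quotient.mk l : Λ ⧸ C.Γ))
    (y := (Submodule.Quotient.mk m : Λ ⧸ C.Γ))).trans (Submodule.Quotient.eq C.Γ)

theorem rep_rep (C : CentralSection 𝓑) (l : Λ) : C.rep (C.rep l) = C.rep l :=
  C.rep_eq_iff.2 (C.rep_sub_mem l)

theorem z_mul_mul (C : CentralSection 𝓑) (g g' : C.Γ) (b : B) :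
    C.z g * (C.z g' * b) = C.z (g + g') * b := by
  rw [C.add, (C.central g).left_assoc]

theorem z_mul_inj (C : CentralSection 𝓑) (g : C.Γ) {b : B} (h : C.z g * b = 0) : b = 0 := by
  have := C.z_mul_mul (-g) g b
  rwa [h, mul_zero, neg_add_cancel, C.zero, one_mul, eq_comm] at this

theorem injOn_rep_add (C : CentralSection 𝓑) {S S' : Finset Λ} {d : Λ} (hS : Set.InjOn C.rep S)
    (hS' : ∀ l ∈ S', ∃ m ∈ S, l = m + d) : Set.InjOn C.rep S' := by
  intro l hl l' hl' e
  obtain ⟨m, hm, rfl⟩ := hS' l hl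
  obtain ⟨m', hm', rfl⟩ := hS' l' hl'
  rw [hS hm hm' (C.rep_eq_iff.2 (by simpa using C.rep_eq_iff.1 e))]

variable [SMulCommClass k B B]

/-- The idempotent linear map that multiplies each homogeneous element by the central element that
moves its degree to the representative of its coset. -/
noncomputable def retract (C : CentralSection 𝓑) (h : IsGrading 𝓑) : B →ₗ[k] B :=
  h.lift fun l => LinearMap.mulLeft k (C.z ⟨C.rep l - l, C.rep_sub_mem l⟩)

theorem retract_of_mem (C : CentralSection 𝓑) (h : IsGrading 𝓑) {l : Λ} {x : B} (hx : x ∈ 𝓑 l) :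
    C.retract h x = C.z ⟨C.rep l - l, C.rep_sub_mem l⟩ * x := by
  rw [retract, h.lift_of_mem _ hx, LinearMap.mulLeft_apply]

theorem retract_mem (C : CentralSection 𝓑) (h : IsGrading 𝓑) {l : Λ} {x : B} (hx : x ∈ 𝓑 l) :
    C.retract h x ∈ 𝓑 (C.rep l) := by
  rw [C.retract_of_mem h hx]
  simpa using h.mul_mem _ _ _ (C.mem ⟨C.rep l - l, C.rep_sub_mem l⟩) _ hx

theorem retract_eq_zero_of_mem (C : CentralSection 𝓑) (h : IsGrading 𝓑) {l : Λ} {x : B}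
    (hx : x ∈ 𝓑 l) (h0 : C.retract h x = 0) : x = 0 :=
  C.z_mul_inj _ (C.retract_of_mem h hx ▸ h0)

/-- Multiplying by z_g stays in the coset, and by multiplicativity the normalizing factor absorbs
z_g. This is the sense in which z_g becomes 1. -/
theorem retract_z_mul (C : CentralSection 𝓑) (h : IsGrading 𝓑) (g : C.Γ) (b : B) :
    C.retract h (C.z g * b) = C.retract h b := by
  have : C.retract h ∘ₗ LinearMap.mulLeft k (C.z g) = C.retract h := by
    refine h.hom_ext fun l x hx => ?_
    rw [LinearMap.comp_apply, LinearMap.mulLeft_apply, C.retract_of_mem h hx,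
      C.retract_of_mem h (h.mul_mem _ _ _ (C.mem g) _ hx), z_mul_mul]
    congr 2
    ext
    have : C.rep ((g : Λ) + l) = C.rep l := C.rep_eq_iff.2 (by simp)
    simp only [this, Submodule.coe_add]
    abel
  exact LinearMap.congr_fun this b

theorem retract_retract (C : CentralSection 𝓑) (h : IsGrading 𝓑) (b : B) :
    C.retract h (C.retract h b) = C.retract h b := by
  have : C.retract h ∘ₗ C.retract h = C.retract h := by
    refine h.hom_ext fun l x hx => ?_
    rw [LinearMap.comp_apply, C.retract_of_mem h hx, C.retract_z_mul, C.retract_of_mem h hx]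
  exact LinearMap.congr_fun this b

variable [IsScalarTower k B B]

/-- On homogeneous elements the inner retraction is multiplication by a central z_g, which moves
outside the product and is absorbed. With its mirror image, this makes the kernel an ideal. -/
theorem retract_retract_mul (C : CentralSection 𝓑) (h : IsGrading 𝓑) (a b : B) :
    C.retract h (C.retract h a * b) = C.retract h (a * b) := by
  have : C.retract h ∘ₗ LinearMap.mulRight k b ∘ₗ C.retract h =
      C.retract h ∘ₗ LinearMap.mulRight k b := by
    refine h.hom_ext fun l x hx => ?_
    simp only [LinearMap.comp_apply, LinearMap.mulRight_apply]
    rw [C.retract_of_mem h hx, ← (C.central _).left_assoc, C.retract_z_mul]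
  exact LinearMap.congr_fun this a

theorem retract_mul_retract (C : CentralSection 𝓑) (h : IsGrading 𝓑) (a b : B) :
    C.retract h (a * C.retract h b) = C.retract h (a * b) := by
  have : C.retract h ∘ₗ LinearMap.mulLeft k a ∘ₗ C.retract h =
      C.retract h ∘ₗ LinearMap.mulLeft k a := by
    refine h.hom_ext fun l x hx => ?_
    simp only [LinearMap.comp_apply, LinearMap.mulLeft_apply]
    rw [C.retract_of_mem h hx, (C.central _).mul_left_comm, C.retract_z_mul]
  exact LinearMap.congr_fun this b

theorem proj_rep_retract (C : CentralSection 𝓑) (h : IsGrading 𝓑) {x : B} {l : Λ}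
    (hx : ∀ m ∈ h.supp x, C.rep m = C.rep l → m = l) :
    h.proj (C.rep l) (C.retract h x) = C.retract h (h.proj l x) := by
  conv_lhs => rw [← h.sum_proj x, map_sum, map_sum]
  have hm : ∀ m ∈ h.supp x, m ≠ l → h.proj (C.rep l) (C.retract h (h.proj m x)) = 0 :=
    fun m hm hml => h.proj_of_mem_ne (C.retract_mem h (h.proj_mem _ _)) fun e => hml (hx m hm e)
  rw [Finset.sum_eq_single l hm]
  · exact h.proj_of_mem (C.retract_mem h (h.proj_mem _ _))
  · intro hl
    rw [not_not.1 (mt h.mem_supp.2 hl), map_zero, map_zero]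

/-- When degrees are pairwise incongruent modulo Γ, the components cannot cancel after retraction,
and retraction is injective on each of them. -/
theorem eq_zero_of_retract_eq_zero (C : CentralSection 𝓑) (h : IsGrading 𝓑) {x : B}
    (hx : Set.InjOn C.rep (h.supp x)) (h0 : C.retract h x = 0) : x = 0 := by
  refine h.ext_proj fun l => ?_
  rw [map_zero]
  by_contra hl
  refine hl (C.retract_eq_zero_of_mem h (h.proj_mem l x) ?_)
  rw [← C.proj_rep_retract h fun m hm e => hx hm (h.mem_supp.2 hl) e, h0, map_zero]

theorem card_le_of_shift {S S' : Finset Λ} {d : Λ}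
    (hS' : ∀ l ∈ S', ∃ m ∈ S, l = m + d) : S'.card ≤ S.card := by
  classical
  refine (Finset.card_le_card (t := S.image (· + d)) fun l hl => ?_).trans Finset.card_image_le
  obtain ⟨m, hm, rfl⟩ := hS' l hl
  exact Finset.mem_image_of_mem _ hm

/-- An ideal that contains the kernel of the retraction properly contains the identity. -/
theorem one_mem_of_ideal (C : CentralSection 𝓑) (h : IsGrading 𝓑)
    (hinv : ∀ l, ∀ x ∈ 𝓑 l, x ≠ 0 → ∃ y ∈ 𝓑 (-l), x * y = 1) (J : Submodule k B)
    (hJ : ∀ x ∈ J, ∀ a : B, a * x ∈ J ∧ x * a ∈ J) (hker : LinearMap.ker (C.retract h) < J) :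
    (1 : B) ∈ J := by
  classical
  obtain ⟨hle, hnle⟩ := SetLike.lt_iff_le_and_exists.1 hker
  have hsupp : ∀ {E : B →ₗ[k] B} {d : Λ}, (∀ l, ∀ x ∈ 𝓑 l, E x ∈ 𝓑 (l + d)) → ∀ x,
      ∀ l ∈ h.supp (E x), ∃ m ∈ h.supp x, l = m + d ∧ E (h.proj m x) ≠ 0 := by
    intro E d hE x l hl
    have h1 := h.mem_supp.1 hl
    have h2 := h.proj_shift hE (l - d) x
    rw [sub_add_cancel] at h2
    rw [h2] at h1
    refine ⟨l - d, h.mem_supp.2 fun e => h1 (by rw [e, map_zero]), by simp, h1⟩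
  -- Among the elements of J outside the kernel, one with the fewest homogeneous components is
  -- chosen; any shorter element of J is then in the kernel.
  have hex : ∃ n, ∃ a ∈ J, C.retract h a ≠ 0 ∧ (h.supp a).card = n := by
    obtain ⟨a, ha, ha'⟩ := hnle
    exact ⟨_, a, ha, ha', rfl⟩
  obtain ⟨a, haJ, ha0, hcard⟩ := Nat.find_spec hex
  have hmin : ∀ c ∈ J, (h.supp c).card < Nat.find hex → C.retract h c = 0 := fun c hc hlt => by
    by_contra h0
    exact Nat.find_min hex hlt ⟨c, hc, h0, rfl⟩
  have hRJ : ∀ x ∈ J, C.retract h x ∈ J := fun x hx => by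
    have : C.retract h x - x ∈ J :=
      hle (by rw [LinearMap.mem_ker, map_sub, retract_retract, sub_self])
    simpa using add_mem this hx
  -- replace `a` by its retraction, whose degrees are pairwise incongruent
  have hsub : h.supp (C.retract h a) ⊆ (h.supp a).image C.rep := by
    intro l hl
    by_contra hl'
    refine h.mem_supp.1 hl ?_
    rw [← h.sum_proj a, map_sum, map_sum]
    refine Finset.sum_eq_zero fun m hm => h.proj_of_mem_ne (C.retract_mem h (h.proj_mem _ _)) ?_
    rintro rfl
    exact hl' (Finset.mem_image_of_mem _ hm)
  set b := C.retract h a with hb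
  have hbinj : Set.InjOn C.rep (h.supp b) := by
    intro l hl m hm e
    obtain ⟨l', -, rfl⟩ := Finset.mem_image.1 (hsub hl)
    obtain ⟨m', -, rfl⟩ := Finset.mem_image.1 (hsub hm)
    rwa [rep_rep, rep_rep] at e
  have hbcard : (h.supp b).card ≤ Nat.find hex :=
    ((Finset.card_le_card hsub).trans Finset.card_image_le).trans hcard.le
  obtain ⟨l₀, hl₀⟩ : ∃ l, h.proj l b ≠ 0 := by
    by_contra hall
    push Not at hall
    exact ha0 (h.ext_proj fun l => by rw [hall l, map_zero])
  obtain ⟨y, hy, hxy⟩ := hinv l₀ _ (h.proj_mem _ _) hl₀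
  -- normalize the component of degree zero
  have hEy : ∀ l, ∀ x ∈ 𝓑 l, LinearMap.mulRight k y x ∈ 𝓑 (l + -l₀) :=
    fun l x hx => h.mul_mem _ _ _ hx _ hy
  have hcsupp : ∀ l ∈ h.supp (b * y), ∃ m ∈ h.supp b, l = m + -l₀ := fun l hl => by
    obtain ⟨m, hm, e, -⟩ := hsupp hEy b l hl
    exact ⟨m, hm, e⟩
  have hc0 : h.proj 0 (b * y) = 1 := by
    have := h.proj_shift hEy l₀ b
    rwa [add_neg_cancel, LinearMap.mulRight_apply, LinearMap.mulRight_apply, hxy] at this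
  set c := b * y with hc
  have hcJ : c ∈ J := (hJ b (hRJ a haJ) y).2
  have hcinj := C.injOn_rep_add hbinj hcsupp
  have hccard : (h.supp c).card ≤ Nat.find hex := (card_le_of_shift hcsupp).trans hbcard
  have h1 : (1 : B) ≠ 0 := fun e => ha0 (by rw [hb, ← one_mul (C.retract h a), e, zero_mul])
  have h0c : (0 : Λ) ∈ h.supp c := h.mem_supp.2 (hc0 ▸ h1)
  -- homogeneous operators that vanish at `1` vanish at all components of `c`
  have key : ∀ (E : B →ₗ[k] B) (d : Λ), (∀ l, ∀ x ∈ 𝓑 l, E x ∈ 𝓑 (l + d)) →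
      (∀ x ∈ J, E x ∈ J) → E 1 = 0 → ∀ l, E (h.proj l c) = 0 := by
    intro E d hE hEJ hE1 l
    -- The degree 0 component of `c` is 1, which E kills, so E c is shorter than the minimum and
    -- lies in the kernel. Its degrees are incongruent, so it is 0.
    have hs : ∀ l ∈ h.supp (E c), ∃ m ∈ (h.supp c).erase 0, l = m + d := fun l hl => by
      obtain ⟨m, hm, e, hne⟩ := hsupp hE c l hl
      refine ⟨m, Finset.mem_erase.2 ⟨?_, hm⟩, e⟩
      rintro rfl
      exact hne (by rw [hc0, hE1])
    have hlt : (h.supp (E c)).card < Nat.find hex :=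
      ((card_le_of_shift hs).trans_lt (Finset.card_erase_lt_of_mem h0c)).trans_le hccard
    have hz := C.eq_zero_of_retract_eq_zero h (C.injOn_rep_add (hcinj.mono (by simp)) hs)
      (hmin _ (hEJ c hcJ) hlt)
    rw [← h.proj_shift hE, hz, map_zero]
  have hcen : ∀ l, IsMulCentral (h.proj l c) := by
    intro l
    refine h.isMulCentral (fun m x hx => ?_) (fun m m' x hx x' hx' => ?_)
      (fun m m' x hx x' hx' => ?_)
    · refine sub_eq_zero.1 (key (LinearMap.mulRight k x - LinearMap.mulLeft k x) m
        (fun n w hw => ?_) (fun w hw => ?_) ?_ l)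
      · exact sub_mem (h.mul_mem _ _ _ hw _ hx) (add_comm m n ▸ h.mul_mem _ _ _ hx _ hw)
      · exact sub_mem (hJ w hw x).2 (hJ w hw x).1
      · simp
    · refine sub_eq_zero.1 (key (LinearMap.mulRight k (x * x') -
        LinearMap.mulRight k x' ∘ₗ LinearMap.mulRight k x) (m + m')
        (fun n w hw => ?_) (fun w hw => ?_) ?_ l)
      · exact sub_mem (h.mul_mem _ _ _ hw _ (h.mul_mem _ _ _ hx _ hx'))
          (add_assoc n m m' ▸ h.mul_mem _ _ _ (h.mul_mem _ _ _ hw _ hx) _ hx')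
      · exact sub_mem (hJ w hw _).2 (hJ _ (hJ w hw x).2 x').2
      · simp
    · refine sub_eq_zero.1 (key (LinearMap.mulLeft k (x * x') -
        LinearMap.mulLeft k x ∘ₗ LinearMap.mulLeft k x') (m + m')
        (fun n w hw => ?_) (fun w hw => ?_) ?_ l)
      · refine sub_mem (add_comm (m + m') n ▸ h.mul_mem _ _ _ (h.mul_mem _ _ _ hx _ hx') _ hw) ?_
        have := h.mul_mem _ _ _ hx _ (h.mul_mem _ _ _ hx' _ hw)
        rwa [← add_assoc, add_comm] at this
      · exact sub_mem (hJ w hw _).1 (hJ _ (hJ w hw x').1 x).1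
      · simp
  -- Central components have degrees in Γ, hence congruent to 0, and the degrees of `c` are pairwise
  -- incongruent.
  have hsup : ∀ l ∈ h.supp c, l = 0 := fun l hl => hcinj hl h0c <| C.rep_eq_iff.2 <| by
    rw [sub_zero]
    exact C.maximal l _ (h.proj_mem _ _) (h.mem_supp.1 hl) (hcen l)
  have : c = 1 := by
    rw [← h.sum_proj c, Finset.sum_eq_single_of_mem 0 h0c fun l hl hne => absurd (hsup l hl) hne,
      hc0]
  exact this ▸ hcJ

end CentralSection

end Specialization

/-! ### The algebra structure on the image of the retraction -/

section RetractAlgebra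

/-- The range of a linear endomorphism `T` of an algebra, with the product `T (a * b)`. -/
def RetractAlg {k : Type*} [Field k] {B : Type*} [NonUnitalNonAssocRing B] [Module k B]
    (T : B →ₗ[k] B) : Type _ :=
  LinearMap.range T

variable {k : Type*} [Field k] {B : Type*} [NonUnitalNonAssocRing B] [Module k B]

noncomputable instance (T : B →ₗ[k] B) : AddCommGroup (RetractAlg T) :=
  inferInstanceAs (AddCommGroup (LinearMap.range T))

noncomputable instance (T : B →ₗ[k] B) : Module k (RetractAlg T) :=
  inferInstanceAs (Module k (LinearMap.range T))

/-- The map onto the range. -/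
noncomputable def RetractAlg.mk (T : B →ₗ[k] B) : B →ₗ[k] RetractAlg T := T.rangeRestrict

/-- The inclusion of the range. -/
noncomputable def RetractAlg.val (T : B →ₗ[k] B) : RetractAlg T →ₗ[k] B :=
  (LinearMap.range T).subtype

theorem RetractAlg.val_mk (T : B →ₗ[k] B) (b : B) : val T (mk T b) = T b := rfl

theorem RetractAlg.val_injective (T : B →ₗ[k] B) : Function.Injective (val T) :=
  Subtype.val_injective

theorem RetractAlg.mk_surjective (T : B →ₗ[k] B) : Function.Surjective (mk T) :=
  T.surjective_rangeRestrict

noncomputable instance (T : B →ₗ[k] B) : NonUnitalNonAssocRing (RetractAlg T) where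
  __ := (inferInstance : AddCommGroup (RetractAlg T))
  mul a b := RetractAlg.mk T (RetractAlg.val T a * RetractAlg.val T b)
  left_distrib a b c := by
    change RetractAlg.mk T _ = RetractAlg.mk T _ + RetractAlg.mk T _
    rw [← map_add, ← mul_add, ← map_add]
  right_distrib a b c := by
    change RetractAlg.mk T _ = RetractAlg.mk T _ + RetractAlg.mk T _
    rw [← map_add, ← add_mul, ← map_add]
  zero_mul a := by
    change RetractAlg.mk T (RetractAlg.val T 0 * _) = 0
    rw [map_zero, zero_mul, map_zero]
  mul_zero a := by
    change RetractAlg.mk T (_ * RetractAlg.val T 0) = 0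
    rw [map_zero, mul_zero, map_zero]

theorem RetractAlg.mul_def (T : B →ₗ[k] B) (a b : RetractAlg T) :
    a * b = mk T (val T a * val T b) := rfl

instance [IsScalarTower k B B] (T : B →ₗ[k] B) :
    IsScalarTower k (RetractAlg T) (RetractAlg T) where
  smul_assoc c a b := by
    simp only [smul_eq_mul, RetractAlg.mul_def, map_smul, smul_mul_assoc]

instance [SMulCommClass k B B] (T : B →ₗ[k] B) :
    SMulCommClass k (RetractAlg T) (RetractAlg T) where
  smul_comm c a b := by
    simp only [smul_eq_mul, RetractAlg.mul_def, map_smul, mul_smul_comm]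

end RetractAlgebra

end MultiloopTori

/-! ### An adapted basis of the lattice -/

namespace MultiloopTori

universe v

/-- A basis of a lattice adapted to a subgroup of finite index. -/
theorem exists_basis_dvd_iff {Λ : Type*} [AddCommGroup Λ] [Module.Free ℤ Λ] [Module.Finite ℤ Λ]
    {n : ℕ} (hn : Module.finrank ℤ Λ = n) (Γ : Submodule ℤ Λ)
    (hΓ : ∀ l : Λ, ∃ N : ℕ, 0 < N ∧ N • l ∈ Γ) :
    ∃ (b : Module.Basis (Fin n) ℤ Λ) (m : Fin n → ℕ), (∀ i, 0 < m i) ∧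
      ∀ l, l ∈ Γ ↔ ∀ i, (m i : ℤ) ∣ b.repr l i := by
  have htor : Module.IsTorsion ℤ (Λ ⧸ Γ) := by
    intro x
    induction x using Submodule.Quotient.induction_on with
    | H l =>
      obtain ⟨N, hN, hl⟩ := hΓ l
      refine ⟨⟨N, mem_nonZeroDivisors_of_ne_zero (by exact_mod_cast hN.ne')⟩, ?_⟩
      change (N : ℤ) • Submodule.Quotient.mk l = (0 : Λ ⧸ Γ)
      rw [← Submodule.Quotient.mk_smul, Submodule.Quotient.mk_eq_zero, natCast_zsmul]
      exact hl
  have hrank : Module.finrank ℤ Γ = Module.finrank ℤ Λ := by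
    rw [← Submodule.finrank_quotient_add_finrank Γ, Module.finrank_eq_zero_iff_isTorsion.2 htor,
      zero_add]
  obtain ⟨b, a, c, hc⟩ := Submodule.exists_smith_normal_form_of_rank_eq
    (Module.finBasisOfFinrankEq ℤ Λ hn) hrank
  -- Smith coefficients may be negative, which divisibility ignores; they are nonzero because the
  -- basis vectors of Γ are.
  refine ⟨b, fun i => (a i).natAbs, fun i => Int.natAbs_pos.2 fun h0 => ?_, fun l => ?_⟩
  · refine c.ne_zero i (Subtype.ext ?_)
    rw [hc, h0, zero_smul, Submodule.coe_zero]
  · simp only [Int.natCast_natAbs, abs_dvd]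
    constructor
    · intro hl i
      have := congrArg Subtype.val (c.sum_repr ⟨l, hl⟩)
      simp only [Submodule.coe_sum, Submodule.coe_smul, hc, smul_smul] at this
      rw [← this, ← Module.Basis.equivFun_apply, Module.Basis.equivFun_apply, b.repr_sum_self]
      exact dvd_mul_left _ _
    · intro h
      choose d hd using h
      rw [← b.sum_repr l]
      refine sum_mem fun i _ => ?_
      rw [hd, mul_comm, mul_smul, ← hc]
      exact Γ.smul_mem _ (c i).2

/-! ### The fiber, its automorphisms and the multiloop realization -/

section Realization

set_option linter.unusedSectionVars false

variable {k : Type*} [Field k] {Λ : Type*} [AddCommGroup Λ]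
  {B : Type v} [NonAssocRing B] [Module k B] [IsScalarTower k B B] [SMulCommClass k B B]
  {𝓑 : Λ → Submodule k B}

namespace CentralSection

/-- The algebra obtained by specializing the central elements `z g` to `1`. -/
abbrev Fiber (C : CentralSection 𝓑) (h : IsGrading 𝓑) : Type v := RetractAlg (C.retract h)

/-- The specialization map. -/
noncomputable abbrev toFiber (C : CentralSection 𝓑) (h : IsGrading 𝓑) : B →ₗ[k] C.Fiber h :=
  RetractAlg.mk (C.retract h)

/-- The fiber as a subspace of the torus. -/
noncomputable abbrev ofFiber (C : CentralSection 𝓑) (h : IsGrading 𝓑) : C.Fiber h →ₗ[k] B :=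
  RetractAlg.val (C.retract h)

theorem toFiber_mul (C : CentralSection 𝓑) (h : IsGrading 𝓑) (a b : B) :
    C.toFiber h (a * b) = C.toFiber h a * C.toFiber h b := by
  apply RetractAlg.val_injective
  rw [RetractAlg.mul_def, RetractAlg.val_mk, RetractAlg.val_mk, RetractAlg.val_mk,
    RetractAlg.val_mk, retract_retract_mul, retract_mul_retract]

theorem toFiber_ofFiber (C : CentralSection 𝓑) (h : IsGrading 𝓑) (a : C.Fiber h) :
    C.toFiber h (C.ofFiber h a) = a := by
  obtain ⟨b, rfl⟩ := RetractAlg.mk_surjective _ a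
  apply RetractAlg.val_injective
  rw [RetractAlg.val_mk, RetractAlg.val_mk, retract_retract]

theorem finiteDimensional_fiber (C : CentralSection 𝓑) (h : IsGrading 𝓑)
    (hfd : ∀ l, FiniteDimensional k (𝓑 l)) (F : Finset Λ)
    (hF : ∀ l ∈ support 𝓑, ∃ f ∈ F, l - f ∈ C.Γ) : FiniteDimensional k (C.Fiber h) := by
  have hle : LinearMap.range (C.retract h) ≤ F.sup fun f => 𝓑 (C.rep f) := by
    rintro _ ⟨x, rfl⟩
    induction x using h.induction with
    | zero => simp
    | add x y hx hy => rw [map_add]; exact add_mem hx hy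
    | mem l x hx =>
      by_cases hx0 : x = 0
      · simp [hx0]
      · obtain ⟨f, hf, hlf⟩ := hF l fun e => hx0 (by rwa [e, Submodule.mem_bot] at hx)
        refine Finset.le_sup (f := fun f => 𝓑 (C.rep f)) hf ?_
        rw [← C.rep_eq_iff.2 hlf]
        exact C.retract_mem h hx
  have : FiniteDimensional k (F.sup fun f => 𝓑 (C.rep f) : Submodule k B) :=
    Submodule.finiteDimensional_finset_sup F _
  exact Submodule.finiteDimensional_of_le hle

/-- Ideals of the fiber pull back to ideals of `B` containing the kernel; such an ideal is the
kernel or contains 1. -/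
theorem isSimpleAlg_fiber [Nontrivial B] (C : CentralSection 𝓑) (h : IsGrading 𝓑)
    (hinv : ∀ l, ∀ x ∈ 𝓑 l, x ≠ 0 → ∃ y ∈ 𝓑 (-l), x * y = 1) : IsSimpleAlg k (C.Fiber h) := by
  refine ⟨⟨C.toFiber h 1, C.toFiber h 1, fun e => ?_⟩, fun I hI => ?_⟩
  · rw [← toFiber_mul, one_mul] at e
    refine one_ne_zero (C.retract_eq_zero_of_mem h h.one_mem ?_)
    rw [← RetractAlg.val_mk, e, map_zero]
  · have hker : LinearMap.ker (C.retract h) ≤ I.comap (C.toFiber h) := fun x hx => by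
      have : C.toFiber h x = 0 := RetractAlg.val_injective _ (by rwa [RetractAlg.val_mk, map_zero])
      rw [Submodule.mem_comap, this]
      exact I.zero_mem
    have hJ : ∀ x ∈ I.comap (C.toFiber h), ∀ a : B,
        a * x ∈ I.comap (C.toFiber h) ∧ x * a ∈ I.comap (C.toFiber h) := fun x hx a => by
      simp only [Submodule.mem_comap, toFiber_mul]
      exact hI _ hx _
    rcases hker.eq_or_lt with e | hlt
    · left
      rw [eq_bot_iff]
      intro a ha
      have : C.ofFiber h a ∈ LinearMap.ker (C.retract h) := by
        rw [e, Submodule.mem_comap, toFiber_ofFiber]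
        exact ha
      rw [Submodule.mem_bot, ← C.toFiber_ofFiber h a]
      exact RetractAlg.val_injective _ (by rw [RetractAlg.val_mk, map_zero, this])
    · right
      rw [eq_top_iff]
      intro a _
      have := (hJ 1 (C.one_mem_of_ideal h hinv _ hJ hlt) (C.ofFiber h a)).1
      rwa [mul_one, Submodule.mem_comap, toFiber_ofFiber] at this

/-- The operator that scales the component of degree `l` by `χ (rep l)`. -/
noncomputable def scale (C : CentralSection 𝓑) (h : IsGrading 𝓑) (χ : Λ → kˣ) : B →ₗ[k] B :=
  h.lift fun l => (χ (C.rep l) : k) • LinearMap.id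

theorem scale_of_mem (C : CentralSection 𝓑) (h : IsGrading 𝓑) (χ : Λ → kˣ) {l : Λ} {x : B}
    (hx : x ∈ 𝓑 l) : C.scale h χ x = (χ (C.rep l) : k) • x :=
  h.lift_of_mem _ hx

/-- The scalar is taken at the coset representative, so it is unchanged by retraction for an
arbitrary function χ. -/
theorem retract_scale (C : CentralSection 𝓑) (h : IsGrading 𝓑) (χ : Λ → kˣ) (x : B) :
    C.retract h (C.scale h χ x) = C.scale h χ (C.retract h x) := by
  refine LinearMap.congr_fun (f := C.retract h ∘ₗ C.scale h χ) (g := C.scale h χ ∘ₗ C.retract h)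
    (h.hom_ext fun l x hx => ?_) x
  rw [LinearMap.comp_apply, LinearMap.comp_apply, C.scale_of_mem h χ hx,
    C.scale_of_mem h χ (C.retract_mem h hx), map_smul, rep_rep]

theorem scale_scale (C : CentralSection 𝓑) (h : IsGrading 𝓑) (χ χ' : Λ → kˣ) (x : B) :
    C.scale h χ (C.scale h χ' x) = C.scale h (χ * χ') x := by
  refine LinearMap.congr_fun (f := C.scale h χ ∘ₗ C.scale h χ') (h.hom_ext fun l x hx => ?_) x
  rw [LinearMap.comp_apply, C.scale_of_mem h χ' hx, map_smul, C.scale_of_mem h χ hx,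
    C.scale_of_mem h _ hx, smul_smul, mul_comm, Pi.mul_apply, Units.val_mul]

theorem scale_one (C : CentralSection 𝓑) (h : IsGrading 𝓑) (x : B) : C.scale h 1 x = x := by
  refine LinearMap.congr_fun (g := LinearMap.id) (h.hom_ext fun l x hx => ?_) x
  rw [C.scale_of_mem h 1 hx, Pi.one_apply, Units.val_one, one_smul, LinearMap.id_apply]

theorem scale_mul (C : CentralSection 𝓑) (h : IsGrading 𝓑) {χ : Λ → kˣ}
    (hχ : ∀ l l', χ (C.rep (l + l')) = χ (C.rep l) * χ (C.rep l')) (x y : B) :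
    C.scale h χ (x * y) = C.scale h χ x * C.scale h χ y := by
  induction x using h.induction with
  | zero => simp
  | add x x' hx hx' => simp only [add_mul, map_add, hx, hx']
  | mem l x hx =>
    induction y using h.induction with
    | zero => simp
    | add y y' hy hy' => simp only [mul_add, map_add, hy, hy']
    | mem l' y hy =>
      rw [C.scale_of_mem h χ hx, C.scale_of_mem h χ hy,
        C.scale_of_mem h χ (h.mul_mem _ _ _ hx _ hy), hχ, smul_mul_smul_comm, Units.val_mul]

/-- The scaling operators on the fiber. -/
noncomputable def fiberScale (C : CentralSection 𝓑) (h : IsGrading 𝓑) :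
    (Λ → kˣ) →* (C.Fiber h ≃ₗ[k] C.Fiber h) where
  toFun χ :=
    have key : ∀ χ χ' : Λ → kˣ, χ * χ' = 1 →
        (C.toFiber h ∘ₗ C.scale h χ ∘ₗ C.ofFiber h) ∘ₗ
          (C.toFiber h ∘ₗ C.scale h χ' ∘ₗ C.ofFiber h) = LinearMap.id := fun χ χ' e => by
      ext a
      apply RetractAlg.val_injective
      simp only [LinearMap.comp_apply, RetractAlg.val_mk, LinearMap.id_apply]
      rw [retract_scale, retract_retract, ← retract_scale, scale_scale, e, scale_one,
        ← RetractAlg.val_mk, toFiber_ofFiber]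
    LinearEquiv.ofLinearMap (C.toFiber h ∘ₗ C.scale h χ ∘ₗ C.ofFiber h)
      (C.toFiber h ∘ₗ C.scale h χ⁻¹ ∘ₗ C.ofFiber h)
      (key _ _ (mul_inv_cancel _)) (key _ _ (inv_mul_cancel _))
  map_one' := by
    ext a
    change C.toFiber h (C.scale h 1 (C.ofFiber h a)) = a
    rw [scale_one, toFiber_ofFiber]
  map_mul' χ χ' := by
    ext a
    change C.toFiber h (C.scale h (χ * χ') (C.ofFiber h a)) =
      C.toFiber h (C.scale h χ (C.ofFiber h (C.toFiber h (C.scale h χ' (C.ofFiber h a)))))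
    apply RetractAlg.val_injective
    simp only [RetractAlg.val_mk]
    rw [retract_scale C h χ, retract_retract, ← retract_scale, scale_scale]

theorem fiberScale_toFiber (C : CentralSection 𝓑) (h : IsGrading 𝓑) (χ : Λ → kˣ) (x : B) :
    C.fiberScale h χ (C.toFiber h x) = C.toFiber h (C.scale h χ x) := by
  change C.toFiber h (C.scale h χ (C.ofFiber h (C.toFiber h x))) = _
  apply RetractAlg.val_injective
  simp only [RetractAlg.val_mk]
  rw [← retract_scale, retract_retract]

theorem fiberScale_mul (C : CentralSection 𝓑) (h : IsGrading 𝓑) {χ : Λ → kˣ}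
    (hχ : ∀ l l', χ (C.rep (l + l')) = χ (C.rep l) * χ (C.rep l')) (a a' : C.Fiber h) :
    C.fiberScale h χ (a * a') = C.fiberScale h χ a * C.fiberScale h χ a' := by
  obtain ⟨x, rfl⟩ := RetractAlg.mk_surjective _ a
  obtain ⟨y, rfl⟩ := RetractAlg.mk_surjective _ a'
  rw [← toFiber_mul, fiberScale_toFiber, fiberScale_toFiber, fiberScale_toFiber, C.scale_mul h hχ,
    toFiber_mul]

/-- An element of the fiber all of whose degrees are congruent to `l` comes from degree `l`. -/
theorem exists_mem_toFiber_eq (C : CentralSection 𝓑) (h : IsGrading 𝓑) {l : Λ} {v : B}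
    (hv : ∀ m ∈ h.supp v, l - m ∈ C.Γ) : ∃ x ∈ 𝓑 l, C.toFiber h x = C.toFiber h v := by
  classical
  let R : B →ₗ[k] B := h.lift fun m =>
    if hm : l - m ∈ C.Γ then LinearMap.mulLeft k (C.z ⟨l - m, hm⟩) else 0
  have hR : ∀ m (hm : l - m ∈ C.Γ), ∀ x ∈ 𝓑 m, R x = C.z ⟨l - m, hm⟩ * x := fun m hm x hx => by
    simp only [R, h.lift_of_mem _ hx, dif_pos hm, LinearMap.mulLeft_apply]
  refine ⟨R v, ?_, RetractAlg.val_injective _ ?_⟩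
  · rw [← h.sum_proj v, map_sum]
    refine sum_mem fun m hm => ?_
    rw [hR m (hv m hm) _ (h.proj_mem _ _)]
    simpa using h.mul_mem _ _ _ (C.mem ⟨l - m, hv m hm⟩) _ (h.proj_mem m v)
  · rw [RetractAlg.val_mk, RetractAlg.val_mk, ← h.sum_proj v, map_sum, map_sum, map_sum]
    refine Finset.sum_congr rfl fun m hm => ?_
    rw [hR m (hv m hm) _ (h.proj_mem _ _), retract_z_mul]

/-- The characters `χ i` jointly detect congruence modulo Γ. Hence a simultaneous eigenvector with
eigenvalues `χ i l` has only degrees congruent to l, and so comes from a unique element of degree l.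
-/
theorem hasMultiloopRealization (C : CentralSection 𝓑) (h : IsGrading 𝓑) (ζ : ℕ → kˣ)
    (hζ : ∀ l : ℕ, 1 ≤ l → IsPrimitiveRoot (ζ l) l) {n : ℕ} (b : Module.Basis (Fin n) ℤ Λ)
    (m : Fin n → ℕ) (hm : ∀ i, 0 < m i) (hΓ : ∀ l, l ∈ C.Γ ↔ ∀ i, (m i : ℤ) ∣ b.repr l i) :
    HasMultiloopRealization ζ n 𝓑 (C.Fiber h) := by
  let χ : Fin n → Λ → kˣ := fun i l => ζ (m i) ^ b.repr l i
  have hχ_iff : ∀ i l l', χ i l = χ i l' ↔ (m i : ℤ) ∣ b.repr (l - l') i := fun i l l' => by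
    rw [← (hζ (m i) (hm i)).zpow_eq_one_iff_dvd, map_sub, Finsupp.sub_apply, zpow_sub,
      mul_inv_eq_one]
  have hχ_add : ∀ i l l', χ i (l + l') = χ i l * χ i l' := fun i l l' => by
    simp only [χ, map_add, Finsupp.add_apply, zpow_add]
  have hχ_rep : ∀ i l, χ i (C.rep l) = χ i l := fun i l =>
    (hχ_iff i _ _).2 ((hΓ _).1 (C.rep_sub_mem l) i)
  have hχ_pow : ∀ i, χ i ^ m i = 1 := fun i => funext fun l => by
    simp only [χ, Pi.pow_apply, Pi.one_apply]
    rw [← zpow_natCast, ← zpow_mul, mul_comm, zpow_mul, zpow_natCast, (hζ (m i) (hm i)).pow_eq_one,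
      one_zpow]
  let D : MultiloopDatum k (C.Fiber h) n :=
    { m := m
      m_pos := hm
      σ := fun i => C.fiberScale h (χ i)
      map_mul := fun i => C.fiberScale_mul h fun l l' => by rw [hχ_rep, hχ_rep, hχ_rep, hχ_add]
      commute := fun i j => (Commute.all (χ i) (χ j)).map (C.fiberScale h)
      pow_eq_one := fun i => by rw [← map_pow, hχ_pow, map_one] }
  let ν : Λ ≃+ (Fin n → ℤ) := b.equivFun.toAddEquiv
  let φ : B →ₗ[k] C.Fiber h ⊗[k] Laurent k n := h.lift fun l =>
    (TensorProduct.mk k (C.Fiber h) (Laurent k n)).flip (AddMonoidAlgebra.single (ν l) 1) ∘ₗ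
      C.toFiber h
  have hφ : ∀ l, ∀ x ∈ 𝓑 l, φ x = C.toFiber h x ⊗ₜ[k] AddMonoidAlgebra.single (ν l) 1 :=
    fun l x hx => h.lift_of_mem _ hx
  have hφ_mul : ∀ x y, φ (x * y) = φ x * φ y := fun x y => by
    induction x using h.induction with
    | zero => simp
    | add x x' hx hx' => simp only [add_mul, map_add, hx, hx']
    | mem l x hx =>
      induction y using h.induction with
      | zero => simp
      | add y y' hy hy' => simp only [mul_add, map_add, hy, hy']
      | mem l' y hy =>
        rw [hφ l x hx, hφ l' y hy, hφ _ _ (h.mul_mem _ _ _ hx _ hy), toFiber_mul,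
          Algebra.TensorProduct.tmul_mul_tmul, AddMonoidAlgebra.single_mul_single, map_add,
          mul_one]
  have hφ_inj : Function.Injective φ := by
    -- This reads off the coefficient of z^{ν l}; injectivity then reduces to that of the retraction
    -- on one component.
    let coord : Λ → C.Fiber h ⊗[k] Laurent k n →ₗ[k] C.Fiber h := fun l =>
      (TensorProduct.rid k (C.Fiber h)).toLinearMap ∘ₗ LinearMap.lTensor (C.Fiber h)
        (Finsupp.lapply (ν l) ∘ₗ (AddMonoidAlgebra.coeffLinearEquiv k).toLinearMap)
    have hcoord : ∀ l x, coord l (φ x) = C.toFiber h (h.proj l x) := fun l x => by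
      induction x using h.induction with
      | zero => simp
      | add x y hx hy => simp only [map_add, hx, hy]
      | mem l' x hx =>
        rw [hφ l' x hx]
        by_cases e : l' = l
        · subst e
          simp [coord, h.proj_of_mem hx]
        · simp [coord, h.proj_of_mem_ne hx e, e]
    rw [injective_iff_map_eq_zero]
    intro x hx
    refine h.ext_proj fun l => ?_
    rw [map_zero]
    refine C.retract_eq_zero_of_mem h (h.proj_mem l x) ?_
    rw [← RetractAlg.val_mk, ← hcoord, hx, map_zero, map_zero]
  have hφ_map : ∀ l, (𝓑 l).map φ = D.component ζ (ν l) := fun l => by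
    apply le_antisymm
    · rintro _ ⟨x, hx, rfl⟩
      refine ⟨C.toFiber h x, fun j => ?_, (hφ l x hx).symm⟩
      change C.fiberScale h (χ j) (C.toFiber h x) = (χ j l : k) • C.toFiber h x
      rw [fiberScale_toFiber, C.scale_of_mem h _ hx, hχ_rep, map_smul]
    · rintro _ ⟨u, hu, rfl⟩
      obtain ⟨x, hx, hxu⟩ := C.exists_mem_toFiber_eq h (l := l) (v := C.ofFiber h u)
        fun p hp => by
          rw [← neg_mem_iff, neg_sub, hΓ]
          intro i
          have hi : C.fiberScale h (χ i) u = (χ i l : k) • u := hu i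
          have h1 : C.scale h (χ i) (C.ofFiber h u) = (χ i l : k) • C.ofFiber h u := by
            rw [← map_smul, ← hi]
            conv_rhs => rw [← C.toFiber_ofFiber h u, fiberScale_toFiber, RetractAlg.val_mk,
              retract_scale, ← RetractAlg.val_mk (C.retract h), toFiber_ofFiber]
          -- Scaling preserves degrees, so the eigenvector equation holds on the nonzero component
          -- of degree p and forces χ_i(p) = χ_i(l).
          have h2 := h.proj_map (f := id) Function.injective_id (E := C.scale h (χ i))
            (fun q x hx => by
              rw [C.scale_of_mem h _ hx]
              exact Submodule.smul_mem _ _ hx) p (C.ofFiber h u)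
          rw [id, h1, map_smul, C.scale_of_mem h _ (h.proj_mem _ _), hχ_rep] at h2
          rw [← hχ_iff]
          exact Units.ext (smul_left_injective k (h.mem_supp.1 hp) h2.symm)
      refine ⟨x, hx, ?_⟩
      rw [hφ l x hx, hxu, toFiber_ofFiber]
      rfl
  have hφ_range : LinearMap.range φ = NonUnitalSubalgebra.toSubmodule (D.algebra ζ) := by
    change LinearMap.range φ = ⨆ l, D.component ζ l
    rw [LinearMap.range_eq_map, ← h.iSup_eq_top, Submodule.map_iSup]
    simp only [hφ_map]
    exact ν.toEquiv.iSup_comp (g := D.component ζ)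
  let ψ : B ≃ₗ[k] D.algebra ζ :=
    (LinearEquiv.ofInjective φ hφ_inj).trans (LinearEquiv.ofEq _ _ hφ_range)
  refine ⟨D, ψ, ν, fun x y => Subtype.ext (hφ_mul x y), fun l => ?_⟩
  ext y
  constructor
  · rintro ⟨x, hx, rfl⟩
    change φ x ∈ D.component ζ (ν l)
    rw [← hφ_map]
    exact ⟨x, hx, rfl⟩
  · intro hy
    change (y : C.Fiber h ⊗[k] Laurent k n) ∈ D.component ζ (ν l) at hy
    rw [← hφ_map] at hy
    obtain ⟨x, hx, hxy⟩ := hy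
    exact ⟨x, hx, Subtype.ext hxy⟩

end CentralSection

end Realization

end MultiloopTori

namespace MultiloopTori

universe v

/-! ### Multiloop algebras with finite-dimensional components are fgc -/

section Forward

variable {k : Type*} [Field k] {A : Type*} [NonUnitalNonAssocRing A] [Module k A]
  [IsScalarTower k A A] [SMulCommClass k A A] {n : ℕ}

/-- Multiplication by the monomial `z ^ p`. -/
noncomputable def monomialShift (k : Type*) [Field k] (A : Type*) [NonUnitalNonAssocRing A]
    [Module k A] {n : ℕ} (p : Fin n → ℤ) : A ⊗[k] Laurent k n →ₗ[k] A ⊗[k] Laurent k n :=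
  LinearMap.lTensor A (LinearMap.mulLeft k (AddMonoidAlgebra.single p 1))

theorem monomialShift_tmul {A : Type*} [NonUnitalNonAssocRing A] [Module k A]
    (p : Fin n → ℤ) (u : A) (r : Laurent k n) :
    monomialShift k A p (u ⊗ₜ[k] r) = u ⊗ₜ[k] (AddMonoidAlgebra.single p 1 * r) := rfl

theorem monomialShift_mul_left (p : Fin n → ℤ) (x y : A ⊗[k] Laurent k n) :
    monomialShift k A p (x * y) = monomialShift k A p x * y := by
  induction x using TensorProduct.induction_on with
  | zero => simp
  | add x x' hx hx' => simp only [add_mul, map_add, hx, hx']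
  | tmul u r =>
    induction y using TensorProduct.induction_on with
    | zero => simp
    | add y y' hy hy' => simp only [mul_add, map_add, hy, hy']
    | tmul w s =>
      simp only [monomialShift_tmul, Algebra.TensorProduct.tmul_mul_tmul, mul_assoc]

theorem monomialShift_mul_right (p : Fin n → ℤ) (x y : A ⊗[k] Laurent k n) :
    monomialShift k A p (x * y) = x * monomialShift k A p y := by
  induction x using TensorProduct.induction_on with
  | zero => simp
  | add x x' hx hx' => simp only [add_mul, map_add, hx, hx']
  | tmul u r =>
    induction y using TensorProduct.induction_on with
    | zero => simp
    | add y y' hy hy' => simp only [mul_add, map_add, hy, hy']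
    | tmul w s =>
      simp only [monomialShift_tmul, Algebra.TensorProduct.tmul_mul_tmul, mul_left_comm]

theorem monomialShift_neg {A : Type*} [NonUnitalNonAssocRing A] [Module k A]
    (p : Fin n → ℤ) (x : A ⊗[k] Laurent k n) :
    monomialShift k A p (monomialShift k A (-p) x) = x := by
  induction x using TensorProduct.induction_on with
  | zero => simp
  | add x x' hx hx' => simp only [map_add, hx, hx']
  | tmul u r =>
    rw [monomialShift_tmul, monomialShift_tmul, ← mul_assoc, AddMonoidAlgebra.single_mul_single,
      add_neg_cancel, mul_one, ← AddMonoidAlgebra.one_def, one_mul]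

/-- Eigenspaces depend only on degrees modulo the m_i, because ζ_{m_i}^{p_i} = 1 when m_i ∣ p_i. -/
theorem MultiloopDatum.monomialShift_mem {A : Type*} [NonUnitalNonAssocRing A] [Module k A]
    (D : MultiloopDatum k A n) {ζ : ℕ → kˣ}
    (hζ : ∀ l : ℕ, 1 ≤ l → IsPrimitiveRoot (ζ l) l) {p : Fin n → ℤ}
    (hp : ∀ i, (D.m i : ℤ) ∣ p i) {l : Fin n → ℤ} {x : A ⊗[k] Laurent k n}
    (hx : x ∈ D.component ζ l) : monomialShift k A p x ∈ D.component ζ (p + l) := by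
  obtain ⟨u, hu, rfl⟩ := hx
  refine ⟨u, fun j => ?_, ?_⟩
  · rw [hu j, Pi.add_apply, zpow_add,
      ((hζ (D.m j) (D.m_pos j)).zpow_eq_one_iff_dvd _).2 (hp j), one_mul]
  · simp [monomialShift_tmul, AddMonoidAlgebra.single_mul_single]

theorem mem_centroid {B : Type*} [NonUnitalNonAssocRing B] [Module k B] [IsScalarTower k B B]
    [SMulCommClass k B B] {f : Module.End k B} (hl : ∀ x y, f (x * y) = f x * y)
    (hr : ∀ x y, f (x * y) = x * f y) : f ∈ centroid k B := by
  have hle : multAlgebra k B ≤ Subalgebra.centralizer k {f} := by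
    refine Algebra.adjoin_le ?_
    rintro _ (⟨a, rfl⟩ | ⟨a, rfl⟩)
    · rw [SetLike.mem_coe, Subalgebra.mem_centralizer_iff]
      rintro _ rfl
      exact LinearMap.ext fun x => hr a x
    · rw [SetLike.mem_coe, Subalgebra.mem_centralizer_iff]
      rintro _ rfl
      exact LinearMap.ext fun x => hl x a
  exact (Subalgebra.mem_centralizer_iff k).2 fun g hg =>
    ((Subalgebra.mem_centralizer_iff k).1 (hle hg) f rfl).symm

theorem HasMultiloopRealization.isFgc {ζ : ℕ → kˣ}
    (hζ : ∀ l : ℕ, 1 ≤ l → IsPrimitiveRoot (ζ l) l) {Λ : Type*} [AddCommGroup Λ]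
    {B : Type*} [NonUnitalNonAssocRing B] [Module k B] [IsScalarTower k B B] [SMulCommClass k B B]
    {𝓑 : Λ → Submodule k B} (h : IsGrading 𝓑) (hfd : ∀ l, FiniteDimensional k (𝓑 l))
    (hreal : HasMultiloopRealization ζ n 𝓑 A) : IsFgc k B := by
  classical
  obtain ⟨D, ψ, ν, hψ_mul, hψ_map⟩ := hreal
  have hmem : ∀ l x, x ∈ 𝓑 l ↔ (ψ x : A ⊗[k] Laurent k n) ∈ D.component ζ (ν l) := fun l x => by
    constructor
    · intro hx
      have : ψ x ∈ D.grading ζ (ν l) := hψ_map l ▸ ⟨x, hx, rfl⟩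
      exact this
    · intro hx
      have : ψ x ∈ D.grading ζ (ν l) := hx
      rw [← hψ_map] at this
      obtain ⟨y, hy, e⟩ := this
      exact ψ.injective e ▸ hy
  have hstable : ∀ p : Fin n → ℤ, (∀ i, (D.m i : ℤ) ∣ p i) →
      ∀ x ∈ NonUnitalSubalgebra.toSubmodule (D.algebra ζ),
        monomialShift k A p x ∈ NonUnitalSubalgebra.toSubmodule (D.algebra ζ) := by
    intro p hp x hx
    change x ∈ (⨆ l, D.component ζ l : Submodule k (A ⊗[k] Laurent k n)) at hx
    change monomialShift k A p x ∈ (⨆ l, D.component ζ l : Submodule k (A ⊗[k] Laurent k n))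
    induction hx using Submodule.iSup_induction' with
    | mem l x hx => exact Submodule.mem_iSup_of_mem (p + l) (D.monomialShift_mem hζ hp hx)
    | zero => simp
    | add x y _ _ hx hy => rw [map_add]; exact add_mem hx hy
  let f : ∀ p : Fin n → ℤ, (∀ i, (D.m i : ℤ) ∣ p i) → Module.End k B := fun p hp =>
    ψ.symm.toLinearMap ∘ₗ (monomialShift k A p).restrict (hstable p hp) ∘ₗ ψ.toLinearMap
  have hψf : ∀ p hp x, (ψ (f p hp x) : A ⊗[k] Laurent k n) = monomialShift k A p (ψ x) :=
    fun p hp x => congrArg Subtype.val (ψ.apply_symm_apply _)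
  have hext : ∀ x y : B, (ψ x : A ⊗[k] Laurent k n) = ψ y → x = y := fun x y e =>
    ψ.injective (Subtype.ext e)
  have hf : ∀ p hp, f p hp ∈ centroid k B := fun p hp => by
    refine mem_centroid (fun x y => hext _ _ ?_) (fun x y => hext _ _ ?_)
    · rw [hψf _ hp, hψ_mul, hψ_mul, NonUnitalSubalgebra.coe_mul,
        NonUnitalSubalgebra.coe_mul, hψf _ hp, monomialShift_mul_left]
    · rw [hψf _ hp, hψ_mul, hψ_mul, NonUnitalSubalgebra.coe_mul,
        NonUnitalSubalgebra.coe_mul, hψf _ hp, monomialShift_mul_right]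
  -- One degree per residue class modulo (m_i); the components over this box generate.
  let box : Finset (Fin n → ℤ) := Fintype.piFinset fun i => Finset.Ico 0 (D.m i : ℤ)
  have hfg : (box.sup fun q => 𝓑 (ν.symm q)).FG :=
    Submodule.fg_finset_sup _ _ fun q _ => Module.Finite.iff_fg.1 (hfd (ν.symm q))
  obtain ⟨S, hS⟩ := hfg
  refine ⟨⟨S, eq_top_iff.2 fun x _ => ?_⟩⟩
  induction x using h.induction with
  | zero => exact zero_mem _
  | add x y hx hy => exact add_mem (hx trivial) (hy trivial)
  | mem l x hx =>
    let q : Fin n → ℤ := fun i => ν l i % D.m i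
    have hp : ∀ i, (D.m i : ℤ) ∣ (ν l - q) i := fun i => Int.dvd_self_sub_emod
    have hp' : ∀ i, (D.m i : ℤ) ∣ (-(ν l - q)) i := fun i => (hp i).neg_right
    have hy : f _ hp' x ∈ 𝓑 (ν.symm q) := by
      rw [hmem, hψf _ hp', ν.apply_symm_apply]
      have := D.monomialShift_mem hζ hp' ((hmem l x).1 hx)
      rwa [neg_add_eq_sub, sub_sub_cancel] at this
    have hq : q ∈ box := Fintype.mem_piFinset.2 fun i => Finset.mem_Ico.2
      ⟨Int.emod_nonneg _ (by exact_mod_cast (D.m_pos i).ne'),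
        Int.emod_lt_of_pos _ (by exact_mod_cast D.m_pos i)⟩
    have hyS : f _ hp' x ∈ Submodule.span k (S : Set B) := by
      rw [hS]
      exact Finset.le_sup (f := fun q => 𝓑 (ν.symm q)) hq hy
    -- x is shifted down into the box by z^{-p} and recovered by the centroid element z^p.
    have hx' : x = (⟨f _ hp, hf _ hp⟩ : centroid k B) • f _ hp' x := hext _ _ <| by
      change _ = (ψ (f _ hp (f _ hp' x)) : A ⊗[k] Laurent k n)
      rw [hψf _ hp, hψf _ hp', monomialShift_neg]
    rw [hx']
    exact Submodule.smul_mem _ _ (Submodule.span_subset_span k (centroid k B) _ hyS)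

end Forward

/-! ### The criterion, uniformly in the variety -/

theorem IsTorus.finiteDimensional {k : Type*} [Field k] {Λ : Type*} [AddCommGroup Λ]
    {B : Type*} [NonAssocRing B] [Module k B] {𝓑 : Λ → Submodule k B} {Inv : B → Prop}
    (h : IsTorus Inv 𝓑) (l : Λ) : FiniteDimensional k (𝓑 l) := by
  by_cases hl : 𝓑 l = ⊥
  · rw [hl]; infer_instance
  · obtain ⟨x, -, hx⟩ := h.exists_span l hl
    rw [hx]; infer_instance

/-- The criterion for tori in a class of algebras that is closed under homomorphic images and in
which powers of invertible elements do not vanish. -/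
theorem IsTorus.hasSimpleMultiloopRealization_iff {k : Type*} [Field k] (ζ : ℕ → kˣ)
    (hζ : ∀ l : ℕ, 1 ≤ l → IsPrimitiveRoot (ζ l) l)
    {Λ : Type*} [AddCommGroup Λ] [Module.Free ℤ Λ] [Module.Finite ℤ Λ]
    (n : ℕ) (hn : 1 ≤ n) (hΛ : Module.finrank ℤ Λ = n)
    {B : Type v} [NonAssocRing B] [Module k B] [IsScalarTower k B B] [SMulCommClass k B B]
    {𝓑 : Λ → Submodule k B} {Inv : B → Prop} (h : IsTorus Inv 𝓑)
    (hInv : ∀ x, Inv x → ∃ y, x * y = 1)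
    (hpow : Nontrivial B → ∀ x, Inv x → ∀ n, leftPow x n ≠ 0)
    (P : ∀ (A : Type v) [Mul A], Prop)
    (hP : ∀ (A : Type v) [Mul A] (f : B → A), Function.Surjective f →
      (∀ x y, f (x * y) = f x * f y) → P A) :
    HasSimpleMultiloopRealization (k := k) P ζ n 𝓑 ↔ IsFgc k B := by
  constructor
  · rintro ⟨A, _, _, _, _, -, -, -, hreal⟩
    exact hreal.isFgc hζ h.isGrading h.finiteDimensional
  · intro hf
    -- If B = 0, the support is empty and generates only 0, contradicting rank n ≥ 1.
    have hB : Nontrivial B := by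
      by_contra hB
      rw [not_nontrivial_iff_subsingleton] at hB
      have hs : support 𝓑 = ∅ := Set.eq_empty_of_forall_notMem fun l hl =>
        hl (Submodule.eq_bot_of_subsingleton)
      have hcl := h.closure_support
      rw [hs, AddSubgroup.closure_empty] at hcl
      have : Subsingleton Λ := ⟨fun a b => by
        have := fun a : Λ => AddSubgroup.mem_bot.1 (hcl ▸ AddSubgroup.mem_top a)
        rw [this a, this b]⟩
      rw [Module.finrank_zero_of_subsingleton] at hΛ
      omega
    have hsupp : ∀ l ∈ support 𝓑, ∀ n : ℕ, n • l ∈ support 𝓑 := fun l hl n => by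
      obtain ⟨x, hx, hs⟩ := h.exists_span l hl
      intro e
      have := leftPow_mem h.isGrading (hs ▸ Submodule.mem_span_singleton_self x) n
      rw [e, Submodule.mem_bot] at this
      exact hpow hB x hx n this
    obtain ⟨C⟩ := h.nonempty_centralSection hInv
    obtain ⟨F, hF⟩ := h.isGrading.exists_finset_of_isFgc C hf
    obtain ⟨b, m, hm, hΓ⟩ := exists_basis_dvd_iff hΛ C.Γ (h.exists_nsmul_mem C hsupp hf)
    exact ⟨C.Fiber h.isGrading, inferInstance, inferInstance, inferInstance, inferInstance,
      C.finiteDimensional_fiber h.isGrading h.finiteDimensional F hF,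
      C.isSimpleAlg_fiber h.isGrading fun l x hx hx0 => h.exists_mul_eq_one hInv hx hx0,
      hP _ (C.toFiber h.isGrading) (RetractAlg.mk_surjective _) (C.toFiber_mul h.isGrading),
      C.hasMultiloopRealization h.isGrading ζ hζ b m hm hΓ⟩

/-! ### Closure of the three varieties under images -/

section Images

variable {A B : Type*} [Mul A] [Mul B] {f : B → A}

theorem IsAssociativeAlg.of_surjective (h : IsAssociativeAlg B) (hf : Function.Surjective f)
    (hmul : ∀ x y, f (x * y) = f x * f y) : IsAssociativeAlg A := by
  intro x y z
  obtain ⟨x, rfl⟩ := hf x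
  obtain ⟨y, rfl⟩ := hf y
  obtain ⟨z, rfl⟩ := hf z
  simp only [← hmul, h x y z]

theorem IsAlternativeAlg.of_surjective (h : IsAlternativeAlg B) (hf : Function.Surjective f)
    (hmul : ∀ x y, f (x * y) = f x * f y) : IsAlternativeAlg A := by
  constructor <;>
  · intro x y
    obtain ⟨x, rfl⟩ := hf x
    obtain ⟨y, rfl⟩ := hf y
    simp only [← hmul, h.1 x y, h.2 x y]

theorem IsJordanAlg.of_surjective (h : IsJordanAlg B) (hf : Function.Surjective f)
    (hmul : ∀ x y, f (x * y) = f x * f y) : IsJordanAlg A := by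
  refine ⟨fun x y => ?_, fun x y => ?_⟩ <;>
    obtain ⟨x, rfl⟩ := hf x <;> obtain ⟨y, rfl⟩ := hf y
  · rw [← hmul, ← hmul, h.1]
  · simp only [← hmul, h.2 x y]

end Images

end MultiloopTori

theorem mainTheorem4 {k : Type*} [Field k] [IsAlgClosed k] [CharZero k]
    (ζ : ℕ → kˣ) (hζ : ∀ l : ℕ, 1 ≤ l → IsPrimitiveRoot (ζ l) l)
    {Λ : Type*} [AddCommGroup Λ] [Module.Free ℤ Λ] [Module.Finite ℤ Λ]
    (n : ℕ) (hn : 1 ≤ n) (hΛ : Module.finrank ℤ Λ = n)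
    {B : Type*} [NonAssocRing B] [Module k B] [IsScalarTower k B B] [SMulCommClass k B B]
    (𝓑 : Λ → Submodule k B) :
    (MultiloopTori.IsAssociativeTorus 𝓑 →
      (MultiloopTori.HasSimpleMultiloopRealization
          (fun A _ => MultiloopTori.IsAssociativeAlg A) ζ n 𝓑 ↔ MultiloopTori.IsFgc k B)) ∧
    (MultiloopTori.IsAlternativeTorus 𝓑 →
      (MultiloopTori.HasSimpleMultiloopRealization
          (fun A _ => MultiloopTori.IsAlternativeAlg A) ζ n 𝓑 ↔ MultiloopTori.IsFgc k B)) ∧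
    (MultiloopTori.IsJordanTorus 𝓑 →
      (MultiloopTori.HasSimpleMultiloopRealization
          (fun A _ => MultiloopTori.IsJordanAlg A) ζ n 𝓑 ↔ MultiloopTori.IsFgc k B)) := by
  -- Characteristic 0 permits the division by 2 in the Moufang and linearized Jordan identities.
  have h2 : ∀ x : B, 2 • x = 0 → x = 0 := fun x hx => by
    rw [← Nat.cast_smul_eq_nsmul k] at hx
    exact (smul_eq_zero.1 hx).resolve_left (by norm_num)
  refine ⟨fun h => ?_, fun h => ?_, fun h => ?_⟩
  · exact h.2.hasSimpleMultiloopRealization_iff ζ hζ n hn hΛ (fun x ⟨y, hy⟩ => ⟨y, hy.1⟩)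
      (fun _ x hx => h.1.isAlternativeAlg.leftPow_ne_zero h2 hx) _
      fun A _ f hf hmul => h.1.of_surjective hf hmul
  · exact h.2.hasSimpleMultiloopRealization_iff ζ hζ n hn hΛ (fun x ⟨y, hy⟩ => ⟨y, hy.1⟩)
      (fun _ x hx => h.1.leftPow_ne_zero h2 hx) _
      fun A _ f hf hmul => h.1.of_surjective hf hmul
  · exact h.2.hasSimpleMultiloopRealization_iff ζ hζ n hn hΛ (fun x ⟨y, hy⟩ => ⟨y, hy.1⟩)
      (fun _ x hx => h.1.leftPow_ne_zero h2 hx) _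
      fun A _ f hf hmul => h.1.of_surjective hf hmul
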